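/- Let $G=(V,E)$ be a finite simple graph and $M$ a matching of $G$. A vertex is free if it is on no edge of $M$. A path is vertex-simple; it is alternating if its edges are alternately in $M$ and not in $M$, and augmenting if it is alternating and joins two distinct free vertices. A shortest augmenting path (sap) is an augmenting path with the fewest edges. Put $w(e)=2$ for $e\in M$ and $w(e)=0$ for $e\in E\setminus M$, and for a path $P$ let $|P|$ be its number of edges and $w(P)=w(P\setminus M)-w(P\cap M)$. For $S\subseteq V$ let $\gamma(S)$ be the set of edges with both ends in $S$. Run one search of Edmonds' weighted matching algorithm on $G,M,w$, as follows. It maintains vertex duals $y(v)$, a family of blossoms $B\subseteq V$ with $|B|\ge 2$ and duals $z(B)$, a subgraph $\mathcal S$ of $G$, and a labelling of each vertex of $\mathcal S$ as outer or inner. Let $B_x$ be the maximal blossom containing $x$ ($B_x=\{x\}$ if there is none) and $\overline{\mathcal S}$ the forest obtained from $\mathcal S$ by contracting the blossoms. An edge $uv$ is tight if $y(u)+y(v)+\sum_{B\ni u,v}z(B)=w(uv)$. Initially $y\equiv 1$, there are no blossoms, and $\mathcal S$ consists of the free vertices, all outer. While there is a tight edge $xv$ with $x$ outer, $v$ not inner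 and $B_x\ne B_v$, choose any such edge and do the following. * Grow step: if $v\notin V(\mathcal S)$, add $xv$ and $vv'$ to $\mathcal S$, where $vv'\in M$; $v$ becomes inner and $v'$ outer. * Blossom step: if $v$ is outer and in the same tree of $\overline{\mathcal S}$ as $x$, add $xv$ to $\mathcal S$; the vertices of $V$ in the nodes of the fundamental cycle of $xv$ in $\overline{\mathcal S}$ form a new blossom $B$, with $z(B)=0$, and all of them become outer. * Augment: if $v$ is outer and in a different tree of $\overline{\mathcal S}$, halt; an augmenting path has been found. If there is no such edge, do a dual adjustment: let $\delta$ be the minimum of the values $y(u)+y(v)-w(uv)$ over edges $uv$ with $u$ outer and $v\notin V(\mathcal S)$, and $\frac12\bigl(y(u)+y(v)-w(uv)\bigr)$ over edges $uv$ with $u,v$ outer and $B_u\neq B_v$ (if there are no such values, halt without an augmenting path). Decrease $y(v)$ by $\delta$ for each outer $v$, increase $y(v)$ by $\delta$ for each inner $v$, and increase $z(B)$ by $2\delta$ for each maximal outer blossom $B$ with $|B|\ge2$. Suppose the search halts having found an augmenting path. Call a blossom positive if $z(B)>0$ for the final duals. Let $H$ be the multigraph obtained from $G$ by contracting every positive blossom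 and keeping only the edges that are tight for the final duals and join distinct vertices after the contraction; each edge of $H$ is identified with its preimage in $E$, and an edge of $H$ is matched if it is in $M$. The image in $H$ of a path of $G$ is obtained by deleting its edges in $\bigcup\{\gamma(B): B \text{ positive}\}$ and replacing its vertices by the vertices of $H$ that contain them. Then the augmenting paths of $H$ are precisely the images of the saps of $G$. Moreover every augmenting path $P$ of $G$ has $|P|=-w(P)+1$, and an augmenting path of $G$ has maximum weight among all augmenting paths if and only if it is a sap. -/

import Mathlib

noncomputable section

namespace CardMatching

open scoped Classical
open scoped Graph

/-! ### Paths and augmenting paths in multigraphs -/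

/-- A sequence `start, e₁, v₁, e₂, v₂, …` of vertices and edges, stored as the first vertex and
the list of pairs `(eᵢ, vᵢ)`. -/
@[ext] structure EdgePath (α β : Type*) where
  start : α
  steps : List (β × α)

namespace EdgePath

variable {α β : Type*}

/-- The vertices visited, in order. -/
def verts (P : EdgePath α β) : List α := P.start :: P.steps.map Prod.snd

/-- The edges used, in order. -/
def edges (P : EdgePath α β) : List β := P.steps.map Prod.fst

/-- The last vertex. -/
def finish (P : EdgePath α β) : α := P.verts.getLast (by simp [verts])

/-- The length `|P|`: the number of edges. -/
def length (P : EdgePath α β) : ℕ := P.edges.length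

end EdgePath

/-- Starting at `a`, every listed edge joins the current vertex to the vertex listed with it. -/
def Linked {α β : Type*} (K : Graph α β) : α → List (β × α) → Prop
  | _, [] => True
  | a, (e, b) :: l => K.IsLink e a b ∧ Linked K b l

/-- `P` is a vertex-simple path of the multigraph `K`. -/
def IsPath {α β : Type*} (K : Graph α β) (P : EdgePath α β) : Prop :=
  P.start ∈ V(K) ∧ Linked K P.start P.steps ∧ P.verts.Nodup

/-- `v` is a free vertex of `K`: it is on no matched edge. Here `M` is the set of matched edges. -/
def IsFree {α β : Type*} (K : Graph α β) (M : Set β) (v : α) : Prop :=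
  v ∈ V(K) ∧ ∀ e ∈ M, ¬ K.Inc e v

/-- An alternating path: a vertex-simple path whose edges are alternately matched and unmatched. -/
def IsAlternatingPath {α β : Type*} (K : Graph α β) (M : Set β) (P : EdgePath α β) : Prop :=
  IsPath K P ∧ P.edges.IsChain (fun e f => e ∈ M ↔ f ∉ M)

/-- An augmenting path: an alternating path joining two distinct free vertices. -/
def IsAugmentingPath {α β : Type*} (K : Graph α β) (M : Set β) (P : EdgePath α β) : Prop :=
  IsAlternatingPath K M P ∧ IsFree K M P.start ∧ IsFree K M P.finish ∧ P.start ≠ P.finish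

/-- A shortest augmenting path (sap). -/
def IsSap {α β : Type*} (K : Graph α β) (M : Set β) (P : EdgePath α β) : Prop :=
  IsAugmentingPath K M P ∧ ∀ Q, IsAugmentingPath K M Q → P.length ≤ Q.length

/-- The edge weights: `2` on matched edges and `0` on unmatched edges. -/
def edgeWeight {β : Type*} (M : Set β) (e : β) : ℝ := if e ∈ M then 2 else 0

/-- The weight of a path, `w(P) = w(P - M) - w(P ∩ M)`. -/
def pathWeight {α β : Type*} (M : Set β) (P : EdgePath α β) : ℝ :=
  ((P.edges.filter (fun e => e ∉ M)).map (edgeWeight M)).sum -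
    ((P.edges.filter (fun e => e ∈ M)).map (edgeWeight M)).sum

/-- An augmenting path of maximum weight. -/
def IsMaxWeightAugmentingPath {α β : Type*} (K : Graph α β) (M : Set β) (P : EdgePath α β) :
    Prop :=
  IsAugmentingPath K M P ∧ ∀ Q, IsAugmentingPath K M Q → pathWeight M Q ≤ pathWeight M P

/-! ### Contraction -/

/-- The equivalence relation on `V` generated by identifying any two vertices that lie in a common
member of `F`. Its classes are the nodes that result from contracting every member of `F`. -/
def contraction {V : Type*} (F : Set (Finset V)) : Setoid V :=
  Relation.EqvGen.setoid (fun u v => ∃ B ∈ F, u ∈ B ∧ v ∈ B)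

/-- The node containing `v` after contracting every member of `F`. -/
def node {V : Type*} (F : Set (Finset V)) (v : V) : Quotient (contraction F) :=
  Quotient.mk (contraction F) v

/-- The image of a path under a map `π` of vertices to nodes: edges whose ends are identified
disappear, every other edge is kept (as its preimage), and vertices are replaced by nodes. -/
def EdgePath.image {V N : Type*} (π : V → N) (P : EdgePath V (Sym2 V)) : EdgePath N (Sym2 V) where
  start := π P.start
  steps := P.steps.filterMap
    (fun s => if (s.1.map π).IsDiag then none else some (s.1, π s.2))

/-! ### A search of Edmonds' algorithm -/

/-- The data maintained by a search: the duals `y` and `z`, the edge set of the search structure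
`S`, the outer and the inner vertices (together they are the vertices of `S`), and the blossoms
with more than one vertex that have been formed so far. -/
structure SearchState (V : Type*) where
  y : V → ℝ
  z : Finset V → ℝ
  edges : Set (Sym2 V)
  outer : Set V
  inner : Set V
  blossoms : Finset (Finset V)

section Search

variable {V : Type*} {G : SimpleGraph V}

namespace SearchState

/-- The node of `x` when all blossoms formed so far are contracted, i.e. the maximal blossom
`B_x` containing `x` (which is `{x}` if `x` is in no blossom with more than one vertex). -/
def top (s : SearchState V) (x : V) : Quotient (contraction (s.blossoms : Set (Finset V))) :=
  node _ x

/-- The search structure with all blossoms contracted (a forest, apart from isolated nodes for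
the vertices outside `S`). -/
def forest (s : SearchState V) :
    SimpleGraph (Quotient (contraction (s.blossoms : Set (Finset V)))) :=
  SimpleGraph.fromRel (fun a b => ∃ u v, s(u, v) ∈ s.edges ∧ s.top u = a ∧ s.top v = b)

/-- The edge `uv` is tight: `y(u) + y(v) + ∑_{B ∋ u, v} z(B) = w(uv)`. -/
def Tight (s : SearchState V) (M : G.Subgraph) (u v : V) : Prop :=
  s.y u + s.y v + ∑ B ∈ s.blossoms with u ∈ B ∧ v ∈ B, s.z B = edgeWeight M.edgeSet s(u, v)

/-- `xy` is a tight edge of `G` with `x` outer and `B_x ≠ B_y`. -/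
def Eligible (s : SearchState V) (M : G.Subgraph) (x y : V) : Prop :=
  G.Adj x y ∧ s.Tight M x y ∧ x ∈ s.outer ∧ s.top x ≠ s.top y

/-- A grow, blossom or augment step is possible. -/
def StepPossible (s : SearchState V) (M : G.Subgraph) : Prop :=
  ∃ x y, s.Eligible M x y ∧ y ∉ s.inner

/-- An augment step is possible: a tight edge joins two outer vertices in distinct search trees. -/
def AugmentPossible (s : SearchState V) (M : G.Subgraph) : Prop :=
  ∃ x y, s.Eligible M x y ∧ y ∈ s.outer ∧ ¬ s.forest.Reachable (s.top x) (s.top y)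

/-- The quantities whose minimum is the amount `δ` of a dual adjustment. -/
def adjustSet (s : SearchState V) (M : G.Subgraph) : Set ℝ :=
  {d | ∃ u v, G.Adj u v ∧ u ∈ s.outer ∧ v ∉ s.outer ∪ s.inner ∧
      d = s.y u + s.y v - edgeWeight M.edgeSet s(u, v)} ∪
  {d | ∃ u v, G.Adj u v ∧ u ∈ s.outer ∧ v ∈ s.outer ∧ s.top u ≠ s.top v ∧
      d = (s.y u + s.y v - edgeWeight M.edgeSet s(u, v)) / 2}

/-- `B` is a maximal outer blossom (with more than one vertex, so that it has a dual `z(B)`). -/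
def IsMaxOuterBlossom (s : SearchState V) (B : Finset V) : Prop :=
  Maximal (fun C : Finset V => C ∈ s.blossoms ∧ (C : Set V) ⊆ s.outer) B

/-- The state after a grow step along `xv`, where `v'` is the mate of `v`. -/
def grow (s : SearchState V) (x v v' : V) : SearchState V :=
  { s with
    edges := s.edges ∪ {s(x, v), s(v, v')}
    inner := s.inner ∪ {v}
    outer := s.outer ∪ {v'} }

/-- The state after a blossom step for the edge `xv` that forms the blossom `B`. -/
def shrink (s : SearchState V) (x v : V) (B : Finset V) : SearchState V :=
  { s with
    edges := s.edges ∪ {s(x, v)}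
    outer := s.outer ∪ B
    inner := s.inner \ B
    blossoms := insert B s.blossoms }

/-- The state after a dual adjustment by `δ`. -/
def adjust (s : SearchState V) (δ : ℝ) : SearchState V :=
  { s with
    y := fun v => if v ∈ s.inner then s.y v + δ else if v ∈ s.outer then s.y v - δ else s.y v
    z := fun B => if s.IsMaxOuterBlossom B then s.z B + 2 * δ else s.z B }

/-- The initial state: every `y(v)` is `1`, there are no blossoms, and the search structure
consists of the free vertices, which are outer. -/
def initial (M : G.Subgraph) : SearchState V where
  y := fun _ => 1
  z := fun _ => 0
  edges := ∅
  outer := {v | IsFree (Graph.ofSimpleGraph G) M.edgeSet v}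
  inner := ∅
  blossoms := ∅

end SearchState

open SearchState in
/-- One step of the search (other than the augment step, which ends it). The algorithm may choose
any eligible edge. In a blossom step the two ends of the edge `xv` are joined by a path of the
contracted search structure; this path and the edge form the fundamental cycle, and the new
blossom consists of all vertices of `G` in the nodes of that cycle. -/
inductive SearchStep (M : G.Subgraph) : SearchState V → SearchState V → Prop
  | grow (s : SearchState V) (x v v' : V) :
      s.Eligible M x v → v ∉ s.outer ∪ s.inner → M.Adj v v' →
      SearchStep M s (s.grow x v v')
  | blossom (s : SearchState V) (x v : V) (p : s.forest.Walk (s.top x) (s.top v)) (B : Finset V) :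
      s.Eligible M x v → v ∈ s.outer → p.IsPath → (∀ u, u ∈ B ↔ s.top u ∈ p.support) →
      SearchStep M s (s.shrink x v B)
  | adjust (s : SearchState V) (δ : ℝ) :
      ¬ s.StepPossible M → IsLeast (s.adjustSet M) δ →
      SearchStep M s (s.adjust δ)

/-- `s` is a final state of a search for the matching `M` that halts having found an augmenting
path. -/
def IsSuccessfulFinalState (M : G.Subgraph) (s : SearchState V) : Prop :=
  Relation.ReflTransGen (SearchStep M) (SearchState.initial M) s ∧ s.AugmentPossible M

/-! ### The graph `H` -/

/-- The positive blossoms: those with `z(B) > 0`. -/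
def SearchState.positiveBlossoms (s : SearchState V) : Set (Finset V) :=
  {B | B ∈ s.blossoms ∧ 0 < s.z B}

/-- The map from the vertices of `G` to the vertices of `H`. -/
def SearchState.toH (s : SearchState V) (v : V) : Quotient (contraction s.positiveBlossoms) :=
  node s.positiveBlossoms v

/-- The graph `H`: contract every positive blossom of `G` and keep only the tight edges that join
distinct vertices. It is a multigraph whose edges are their preimages in `G`. -/
def graphH (M : G.Subgraph) (s : SearchState V) :
    Graph (Quotient (contraction s.positiveBlossoms)) (Sym2 V) :=
  ((Graph.ofSimpleGraph G).map s.toH).restrict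
    {e | ∃ u v, e = s(u, v) ∧ s.Tight M u v ∧ s.toH u ≠ s.toH v}

end Search

end CardMatching

end

/-! The argument is linear programming duality for the weights 2 and 0. An augmenting path with k
matched edges has 2k + 1 edges and weight -2k, so longest weight and fewest edges agree
(`IsAugmentingPath.length_eq`, `isMaxWeightAugmentingPath_iff`).

The search keeps two invariants (`exists_invariants`). Structurally (`SearchInv`), each blossom has
a base, the only vertex not matched inside it, and even alternating paths lead from the base to
every vertex of the blossom, using as many matched as unmatched edges inside each blossom. For the
duals (`DualInv`), all free vertices share one value y₀, every edge has nonnegative slack, and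
matched edges and edges of the search structure have slack 0.

Expanding w(P) in the duals makes the values at interior vertices cancel. What remains is 2y₀, plus
the sum over blossoms B of z(B) times the defect of P in B (unmatched minus matched edges inside B),
minus the slacks of the unmatched edges. The defect is never positive because B has only one vertex
not matched inside it (`AugTail.defect_le`). So w(P) ≤ 2y₀, with equality exactly when P is tight
and has defect 0 in every positive blossom (`IsAugmentingPath.pathWeight_le` gives the forward half,
`OptWalk.pathWeight_eq` the converse for walks). The tree paths to the ends of the edge that stops
the search, joined by that edge, attain 2y₀ (`exists_optimal`). Hence the saps are the augmenting
paths of weight 2y₀ (`isSap_iff_pathWeight`).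

A path with zero defects visits each node of H at most once and crosses a matched edge there only at
the base, so its image is an augmenting path (`AugTail.image`, `isAugmentingPath_image`). Conversely
a matched edge of H joins the bases of its two nodes, and an unmatched edge can be extended inside
both nodes to their bases by tight balanced paths; gluing these lifts an augmenting path of H to one
of weight 2y₀ (`exists_crossing_walk`, `exists_lift`). -/

namespace CardMatching

open scoped Classical
open scoped Graph

/-! ### Alternating lists of edges -/

section Lists

variable {α β : Type*}

/-- The members of the list are alternately in and not in `M`, the first one being in `M` if and
only if `b` is true. -/
def Alt (M : Set β) : Bool → List β → Prop
  | _, [] => True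
  | b, e :: l => (e ∈ M ↔ b = true) ∧ Alt M (!b) l

@[simp] theorem alt_nil (M : Set β) (b : Bool) : Alt M b [] := trivial

@[simp] theorem alt_cons (M : Set β) (b : Bool) (e : β) (l : List β) :
    Alt M b (e :: l) ↔ (e ∈ M ↔ b = true) ∧ Alt M (!b) l := Iff.rfl

theorem alt_append (M : Set β) (b : Bool) (l₁ l₂ : List β) :
    Alt M b (l₁ ++ l₂) ↔ Alt M b l₁ ∧ Alt M (if Even l₁.length then b else !b) l₂ := by
  induction l₁ generalizing b with
  | nil => simp
  | cons e l ih =>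
    simp only [List.cons_append, alt_cons, ih, List.length_cons, and_assoc, Nat.even_add_one]
    by_cases h : Even l.length <;> simp [h]

theorem alt_append_of_even {M : Set β} {b : Bool} {l₁ l₂ : List β} (h : Even l₁.length) :
    Alt M b (l₁ ++ l₂) ↔ Alt M b l₁ ∧ Alt M b l₂ := by
  simp [alt_append, h]

theorem alt_append_of_odd {M : Set β} {b : Bool} {l₁ l₂ : List β} (h : ¬ Even l₁.length) :
    Alt M b (l₁ ++ l₂) ↔ Alt M b l₁ ∧ Alt M (!b) l₂ := by
  simp [alt_append, h]

theorem Alt.reverse {M : Set β} {b : Bool} {l : List β} (h : Alt M b l) :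
    Alt M (if Even l.length then !b else b) l.reverse := by
  induction l generalizing b with
  | nil => simp
  | cons e l ih =>
    obtain ⟨h1, h2⟩ := h
    have := ih h2
    simp only [List.reverse_cons, alt_append, List.length_reverse, List.length_cons,
      Nat.even_add_one]
    by_cases h : Even l.length <;> simp_all

theorem Alt.isChain {M : Set β} {b : Bool} {l : List β} (h : Alt M b l) :
    l.IsChain (fun e f => e ∈ M ↔ f ∉ M) := by
  induction l generalizing b with
  | nil => simp
  | cons e l ih =>
    cases l with
    | nil => simp
    | cons f l =>
      rw [List.isChain_cons_cons]
      refine ⟨?_, ih h.2⟩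
      obtain ⟨h1, h2, -⟩ := h
      cases b <;> simp_all

theorem alt_of_isChain {M : Set β} {b : Bool} {e : β} {l : List β}
    (h : (e :: l).IsChain (fun e f => e ∈ M ↔ f ∉ M)) (he : e ∈ M ↔ b = true) :
    Alt M b (e :: l) := by
  induction l generalizing b e with
  | nil => simpa using he
  | cons f l ih =>
    rw [List.isChain_cons_cons] at h
    refine ⟨he, ih h.2 ?_⟩
    cases b <;> simp_all

theorem Alt.odd_length {M : Set β} {l : List β} (h : Alt M false l) (hl : l ≠ [])
    (hlast : l.getLast hl ∉ M) : Odd l.length := by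
  obtain ⟨l', e, rfl⟩ := List.eq_nil_or_concat' l |>.resolve_left hl
  simp only [List.getLast_append_singleton] at hlast
  rw [alt_append] at h
  by_contra hodd
  have : ¬ Even l'.length := by simpa [Nat.even_add_one, Nat.odd_add_one] using hodd
  simp [this, hlast] at h

/-- `1` on unmatched edges and `-1` on matched edges. -/
noncomputable def edgeSign (M : Set β) (e : β) : ℝ := if e ∈ M then -1 else 1

theorem pathWeight_eq (M : Set β) (P : EdgePath α β) :
    pathWeight M P = (P.edges.map (fun e => edgeSign M e * edgeWeight M e)).sum := by
  unfold pathWeight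
  induction P.edges with
  | nil => simp
  | cons e l ih =>
    by_cases he : e ∈ M
    · simp [he, edgeSign, edgeWeight] at ih ⊢
      linarith
    · simp [he, edgeSign, edgeWeight] at ih ⊢
      linarith

/-- An unmatched edge contributes 0 and a matched one -2, hence -1 per edge on average over
consecutive pairs; the last term corrects for an unpaired edge. -/
theorem Alt.sum_weight {M : Set β} {l : List β} {b : Bool} (h : Alt M b l) :
    (l.map (fun e => edgeSign M e * edgeWeight M e)).sum =
      - l.length + (if Even l.length then 0 else (if b then -1 else 1)) := by
  induction l generalizing b with
  | nil => simp
  | cons e l ih =>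
    obtain ⟨h1, h2⟩ := h
    have := ih h2
    rw [List.map_cons, List.sum_cons, this]
    by_cases ho : Even l.length <;> cases b <;>
      simp_all [edgeSign, edgeWeight, Nat.even_add_one, -Nat.not_even_iff_odd] <;> ring

/-! ### Paths in multigraphs -/

theorem Linked.append {K : Graph α β} {a : α} {l₁ l₂ : List (β × α)} :
    Linked K a (l₁ ++ l₂) ↔
      Linked K a l₁ ∧ Linked K ((a :: l₁.map Prod.snd).getLast (by simp)) l₂ := by
  induction l₁ generalizing a with
  | nil => simp [Linked]
  | cons s l ih =>
    obtain ⟨e, v⟩ := s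
    simp [Linked, ih, and_assoc]

theorem EdgePath.finish_eq (P : EdgePath α β) :
    P.finish = (P.start :: P.steps.map Prod.snd).getLast (by simp) := rfl

theorem Linked.inc_last {K : Graph α β} {a : α} {l : List (β × α)} (h : Linked K a l)
    (hl : l ≠ []) :
    K.Inc ((l.map Prod.fst).getLast (by simpa using hl))
      ((a :: l.map Prod.snd).getLast (by simp)) := by
  obtain ⟨l', ⟨e, v⟩, rfl⟩ := List.eq_nil_or_concat' l |>.resolve_left hl
  rw [Linked.append] at h
  have := h.2.1.inc_right
  simpa using this

/-- Free ends force the first and last edges to be unmatched, hence odd length. Conversely odd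
length excludes the trivial path, and simplicity then makes the ends distinct. This form suits
inductions that remove two edges at a time. -/
theorem isAugmentingPath_iff {K : Graph α β} {M : Set β} {P : EdgePath α β} :
    IsAugmentingPath K M P ↔ Linked K P.start P.steps ∧
      (P.start :: P.steps.map Prod.snd).Nodup ∧ Alt M false (P.steps.map Prod.fst) ∧
      Odd P.steps.length ∧ IsFree K M P.start ∧
      IsFree K M ((P.start :: P.steps.map Prod.snd).getLast (by simp)) := by
  constructor
  · rintro ⟨⟨⟨hV, hL, hN⟩, hC⟩, hs, hf, hne⟩
    have hsteps : P.steps ≠ [] := by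
      intro h
      apply hne
      simp [EdgePath.finish, EdgePath.verts, h]
    have hA : Alt M false (P.steps.map Prod.fst) := by
      unfold EdgePath.edges at hC
      rcases hst : P.steps with - | ⟨⟨e, v⟩, l⟩
      · simp
      · rw [hst] at hC hL
        refine alt_of_isChain hC ?_
        simp only [Bool.false_eq_true, iff_false]
        exact fun he => hs.2 e he hL.1.inc_left
    refine ⟨hL, hN, hA, ?_, hs, hf⟩
    have h2 := hA.odd_length (by simpa using hsteps) (fun he => hf.2 _ he (hL.inc_last hsteps))
    simpa using h2
  · rintro ⟨hL, hN, hA, hO, hs, hf⟩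
    refine ⟨⟨⟨hs.1, hL, hN⟩, hA.isChain⟩, hs, hf, ?_⟩
    intro h
    rcases hst : P.steps with - | ⟨s, l⟩
    · simp [hst] at hO
    · have hmem : P.start ∈ P.steps.map Prod.snd := by
        rw [h, EdgePath.finish_eq]
        simp only [hst, List.map_cons]
        rw [List.getLast_cons (by simp)]
        exact List.getLast_mem _
      exact (List.nodup_cons.1 hN).1 hmem

theorem IsAugmentingPath.length_eq {K : Graph α β} {M : Set β} {P : EdgePath α β}
    (h : IsAugmentingPath K M P) : (P.length : ℝ) = -pathWeight M P + 1 := by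
  obtain ⟨-, -, hA, hO, -, -⟩ := isAugmentingPath_iff.1 h
  have hO' : Odd (P.steps.map Prod.fst).length := by simpa using hO
  rw [pathWeight_eq]
  have := hA.sum_weight
  rw [if_neg (Nat.not_even_iff_odd.2 hO')] at this
  simp only [EdgePath.length, EdgePath.edges] at this ⊢
  rw [this]
  simp

theorem isMaxWeightAugmentingPath_iff {K : Graph α β} {M : Set β} {P : EdgePath α β} :
    IsMaxWeightAugmentingPath K M P ↔ IsSap K M P := by
  have key : IsAugmentingPath K M P → ∀ Q, IsAugmentingPath K M Q →
      (pathWeight M Q ≤ pathWeight M P ↔ P.length ≤ Q.length) := by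
    intro hP Q hQ
    have h1 := hP.length_eq
    have h2 := hQ.length_eq
    rw [← Nat.cast_le (α := ℝ), h1, h2]
    constructor <;> intro h <;> linarith
  exact ⟨fun ⟨h, h'⟩ => ⟨h, fun Q hQ => (key h Q hQ).1 (h' Q hQ)⟩,
    fun ⟨h, h'⟩ => ⟨h, fun Q hQ => (key h Q hQ).2 (h' Q hQ)⟩⟩

end Lists

/-! ### The contraction of a laminar family -/

/-- Any two members are disjoint or comparable. -/
def Laminar {V : Type*} (F : Set (Finset V)) : Prop :=
  ∀ B ∈ F, ∀ C ∈ F, ∀ u, u ∈ B → u ∈ C → B ⊆ C ∨ C ⊆ B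

/-- Laminarity makes the generating relation transitive already: of two members that share a vertex,
the larger one contains both pairs. -/
theorem node_eq_iff {V : Type*} {F : Set (Finset V)} (hF : Laminar F) {u v : V} :
    node F u = node F v ↔ u = v ∨ ∃ B ∈ F, u ∈ B ∧ v ∈ B := by
  unfold node
  rw [Quotient.eq]
  constructor
  · intro h
    induction h with
    | rel _ _ h => exact Or.inr h
    | refl _ => exact Or.inl rfl
    | symm _ _ _ ih =>
      rcases ih with rfl | ⟨B, hB, h1, h2⟩
      · exact Or.inl rfl
      · exact Or.inr ⟨B, hB, h2, h1⟩
    | trans _ _ _ _ _ ih1 ih2 =>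
      rcases ih1 with rfl | ⟨B, hB, h1, h2⟩
      · exact ih2
      · rcases ih2 with rfl | ⟨C, hC, h3, h4⟩
        · exact Or.inr ⟨B, hB, h1, h2⟩
        · rcases hF B hB C hC _ h2 h3 with h | h
          · exact Or.inr ⟨C, hC, h h1, h4⟩
          · exact Or.inr ⟨B, hB, h1, h h4⟩
  · rintro (rfl | h)
    · exact Relation.EqvGen.refl _
    · exact Relation.EqvGen.rel _ _ h

/-- Every node is a member of the family or a single vertex. -/
theorem node_eq_member_or_singleton {V : Type*} {F : Set (Finset V)} (hF : Laminar F)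
    (hfin : F.Finite) (v : V) :
    (∃ B ∈ F, v ∈ B ∧ ∀ u, node F u = node F v ↔ u ∈ B) ∨
      ∀ u, node F u = node F v ↔ u = v := by
  by_cases hv : ∃ B ∈ F, v ∈ B
  · left
    obtain ⟨B, ⟨hB, hvB⟩, hmax⟩ := (hfin.subset (Set.sep_subset F (fun B => v ∈ B))).exists_maximal
      (by obtain ⟨B, hB⟩ := hv; exact ⟨B, hB⟩)
    refine ⟨B, hB, hvB, fun u => ?_⟩
    rw [node_eq_iff hF]
    constructor
    · rintro (rfl | ⟨C, hC, huC, hvC⟩)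
      · exact hvB
      · rcases hF C hC B hB v hvC hvB with h | h
        · exact h huC
        · exact hmax ⟨hC, hvC⟩ h huC
    · exact fun h => Or.inr ⟨B, hB, h, hvB⟩
  · right
    intro u
    rw [node_eq_iff hF]
    constructor
    · rintro (rfl | ⟨C, hC, -, hvC⟩)
      · rfl
      · exact absurd ⟨C, hC, hvC⟩ hv
    · exact Or.inl

/-! ### Balance of matched and unmatched edges inside a vertex set -/

section Defect

variable {V : Type*}

/-- Both ends of `e` lie in `C`. -/
def Inside (C : Set V) (e : Sym2 V) : Prop := ∀ u ∈ e, u ∈ C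

@[simp] theorem inside_mk (C : Set V) (a b : V) : Inside C s(a, b) ↔ a ∈ C ∧ b ∈ C := by
  simp [Inside]

/-- The number of unmatched minus the number of matched edges of the list inside `C`. -/
noncomputable def defect (M : Set (Sym2 V)) (C : Set V) (l : List (Sym2 V)) : ℤ :=
  (l.map (fun e => if Inside C e then (if e ∈ M then -1 else 1) else 0)).sum

variable {M : Set (Sym2 V)} {C : Set V}

@[simp] theorem defect_nil : defect M C [] = 0 := rfl

theorem defect_cons (e : Sym2 V) (l : List (Sym2 V)) :
    defect M C (e :: l) = (if Inside C e then (if e ∈ M then -1 else 1) else 0) + defect M C l := by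
  simp [defect]

theorem defect_append (l₁ l₂ : List (Sym2 V)) :
    defect M C (l₁ ++ l₂) = defect M C l₁ + defect M C l₂ := by
  simp [defect]

theorem defect_reverse (l : List (Sym2 V)) : defect M C l.reverse = defect M C l := by
  simp [defect, List.sum_reverse]

theorem defect_eq_zero {l : List (Sym2 V)} (h : ∀ e ∈ l, ¬ Inside C e) : defect M C l = 0 := by
  induction l with
  | nil => rfl
  | cons e l ih =>
    rw [defect_cons, if_neg (h e (by simp)), ih (fun f hf => h f (by simp [hf]))]
    rfl

/-- Consecutive edges cancel, so only the parity of the length and the type of the first edge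
matter. -/
theorem Alt.defect_eq {l : List (Sym2 V)} {b : Bool} (h : Alt M b l) (hC : ∀ e ∈ l, Inside C e) :
    defect M C l = if Even l.length then 0 else (if b then -1 else 1) := by
  induction l generalizing b with
  | nil => simp
  | cons e l ih =>
    rw [defect_cons, if_pos (hC e (by simp)), ih h.2 (fun f hf => hC f (by simp [hf]))]
    have := h.1
    by_cases ho : Even l.length <;> cases b <;>
      simp_all [Nat.even_add_one, -Nat.not_even_iff_odd]

end Defect

section Search

variable {V : Type*} {G : SimpleGraph V}

theorem mate_unique {M : G.Subgraph} (hM : M.IsMatching) {u v w : V} (h : M.Adj u v)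
    (h' : M.Adj u w) : v = w :=
  (hM (M.edge_vert h)).unique h h'

theorem isFree_ofSimpleGraph_iff {M : G.Subgraph} {v : V} :
    IsFree (Graph.ofSimpleGraph G) M.edgeSet v ↔ ∀ u, ¬ M.Adj v u := by
  unfold IsFree
  constructor
  · rintro ⟨-, h⟩ u hu
    refine h s(v, u) hu ?_
    exact ⟨u, by simpa [Graph.ofSimpleGraph] using hu.adj_sub⟩
  · intro h
    refine ⟨by simp [Graph.ofSimpleGraph], ?_⟩
    rintro e he ⟨u, hu⟩
    have : e = s(v, u) := by
      simp [Graph.ofSimpleGraph] at hu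
      tauto
    subst this
    exact h u he

/-! ### Alternating walks that respect a family of blossoms -/

/-- An alternating path with vertices in `S` and edges in `E` that is balanced with respect to every
member of `F`. It ends with a matched edge, if it is nontrivial. -/
structure GoodWalk (M : G.Subgraph) (E : Set (Sym2 V)) (F : Finset (Finset V)) (S : Set V)
    (st : Bool) {a b : V} (w : G.Walk a b) : Prop where
  isPath : w.IsPath
  support_subset : ∀ u ∈ w.support, u ∈ S
  alt : Alt M.edgeSet st w.edges
  even_iff : Even w.length ↔ st = false
  edges_mem : ∀ e ∈ w.edges, e ∈ E
  balanced : ∀ B ∈ F, defect M.edgeSet (B : Set V) w.edges = 0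

namespace GoodWalk

variable {M : G.Subgraph} {E : Set (Sym2 V)} {F : Finset (Finset V)} {S S₁ S₂ : Set V}
  {st : Bool} {a b c d : V}

theorem mono {E' : Set (Sym2 V)} {S' : Set V} {w : G.Walk a b} (h : GoodWalk M E F S st w)
    (hE : E ⊆ E') (hS : S ⊆ S') : GoodWalk M E' F S' st w :=
  ⟨h.isPath, fun u hu => hS (h.support_subset u hu), h.alt, h.even_iff,
    fun e he => hE (h.edges_mem e he), h.balanced⟩

theorem nil (ha : a ∈ S) : GoodWalk M E F S false (SimpleGraph.Walk.nil : G.Walk a a) :=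
  ⟨SimpleGraph.Walk.IsPath.nil, by simpa using ha, by simp, by simp, by simp, by simp⟩

theorem cons_matched {w : G.Walk b c} (h : GoodWalk M E F S false w) (hab : M.Adj a b)
    (hE : s(a, b) ∈ E) (hF : ∀ B ∈ F, a ∈ B → b ∉ B) (ha : a ∉ S) :
    GoodWalk M E F (insert a S) true (SimpleGraph.Walk.cons hab.adj_sub w) where
  isPath := (SimpleGraph.Walk.cons_isPath_iff _ _).2
    ⟨h.isPath, fun h' => ha (h.support_subset _ h')⟩
  support_subset u hu := by
    rw [SimpleGraph.Walk.support_cons, List.mem_cons] at hu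
    rcases hu with rfl | hu
    · exact Set.mem_insert _ _
    · exact Set.mem_insert_of_mem _ (h.support_subset u hu)
  alt := by
    rw [SimpleGraph.Walk.edges_cons, alt_cons]
    exact ⟨by simpa using hab, h.alt⟩
  even_iff := by
    rw [SimpleGraph.Walk.length_cons, Nat.even_add_one]
    simp [h.even_iff]
  edges_mem e he := by
    rw [SimpleGraph.Walk.edges_cons, List.mem_cons] at he
    rcases he with rfl | he
    · exact hE
    · exact h.edges_mem e he
  balanced B hB := by
    rw [SimpleGraph.Walk.edges_cons, defect_cons, h.balanced B hB, if_neg]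
    · rfl
    · rw [inside_mk]
      exact fun h => hF B hB h.1 h.2

theorem reverse {w : G.Walk a b} (h : GoodWalk M E F S true w) :
    GoodWalk M E F S true w.reverse where
  isPath := h.isPath.reverse
  support_subset u hu := h.support_subset u (by simpa using hu)
  alt := by
    have := h.alt.reverse
    have h2 := h.even_iff
    rw [← SimpleGraph.Walk.length_edges] at h2
    simp only [Bool.true_eq_false, iff_false] at h2
    rw [if_neg h2] at this
    rwa [SimpleGraph.Walk.edges_reverse]
  even_iff := by simpa using h.even_iff
  edges_mem e he := h.edges_mem e (by simpa using he)
  balanced B hB := by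
    rw [SimpleGraph.Walk.edges_reverse, defect_reverse, h.balanced B hB]

/-- The first walk ends with a matched edge or is trivial, and the second starts with one, so an
unmatched link keeps the alternation. The link lies in no member of `F` and so changes no defect. -/
theorem append_unmatched {w₁ : G.Walk a b} {w₂ : G.Walk c d} (h₁ : GoodWalk M E F S₁ st w₁)
    (h₂ : GoodWalk M E F S₂ true w₂) (hbc : G.Adj b c) (hM : ¬ M.Adj b c) (hE : s(b, c) ∈ E)
    (hF : ∀ B ∈ F, b ∈ B → c ∉ B) (hS : ∀ u ∈ S₁, u ∉ S₂) :
    GoodWalk M E F (S₁ ∪ S₂) st (w₁.append (SimpleGraph.Walk.cons hbc w₂)) where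
  isPath := by
    rw [SimpleGraph.Walk.isPath_def, SimpleGraph.Walk.support_append,
      SimpleGraph.Walk.support_cons, List.tail_cons, List.nodup_append]
    refine ⟨h₁.isPath.support_nodup, h₂.isPath.support_nodup, ?_⟩
    rintro u hu v hv rfl
    exact hS u (h₁.support_subset u hu) (h₂.support_subset u hv)
  support_subset u hu := by
    rw [SimpleGraph.Walk.support_append, SimpleGraph.Walk.support_cons, List.tail_cons,
      List.mem_append] at hu
    exact hu.imp (h₁.support_subset u) (h₂.support_subset u)
  alt := by
    have h2 := h₁.even_iff
    rw [← SimpleGraph.Walk.length_edges] at h2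
    rw [SimpleGraph.Walk.edges_append, SimpleGraph.Walk.edges_cons, alt_append]
    refine ⟨h₁.alt, ?_⟩
    have h3 : (if Even w₁.edges.length then st else !st) = false := by
      by_cases h : Even w₁.edges.length
      · rw [if_pos h]
        exact h2.1 h
      · have : ¬ st = false := fun h' => h (h2.2 h')
        rw [if_neg h]
        simpa using this
    rw [h3, alt_cons]
    exact ⟨by simpa using hM, h₂.alt⟩
  even_iff := by
    have h3 := h₂.even_iff
    simp only [Bool.true_eq_false, iff_false] at h3
    rw [SimpleGraph.Walk.length_append, SimpleGraph.Walk.length_cons, Nat.even_add,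
      Nat.even_add_one, ← h₁.even_iff]
    simp [h3]
  edges_mem e he := by
    rw [SimpleGraph.Walk.edges_append, SimpleGraph.Walk.edges_cons, List.mem_append,
      List.mem_cons] at he
    rcases he with he | rfl | he
    · exact h₁.edges_mem e he
    · exact hE
    · exact h₂.edges_mem e he
  balanced B hB := by
    rw [SimpleGraph.Walk.edges_append, SimpleGraph.Walk.edges_cons, defect_append, defect_cons,
      h₁.balanced B hB, h₂.balanced B hB, if_neg]
    · rfl
    · rw [inside_mk]
      exact fun h => hF B hB h.1 h.2

/-- The last vertex of a nontrivial good walk is matched within the walk. -/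
theorem exists_mate {w : G.Walk a b} (h : GoodWalk M E F S false w) (hab : a ≠ b) :
    ∃ u ∈ S, M.Adj b u := by
  have halt := h.alt.reverse
  have h2 := h.even_iff
  rw [← SimpleGraph.Walk.length_edges] at h2
  rw [if_pos (h2.2 rfl), ← SimpleGraph.Walk.edges_reverse] at halt
  have hsup : ∀ u ∈ w.reverse.support, u ∈ S := fun u hu =>
    h.support_subset u (by simpa using hu)
  cases hw : w.reverse with
  | nil => exact absurd rfl hab
  | cons hadj q =>
    rename_i u
    rw [hw, SimpleGraph.Walk.edges_cons, alt_cons] at halt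
    refine ⟨u, hsup u ?_, by simpa using halt.1⟩
    rw [hw, SimpleGraph.Walk.support_cons]
    exact List.mem_cons_of_mem _ q.start_mem_support

end GoodWalk

/-! ### The structural invariant of the search -/

/-- The combinatorial invariant of a search. The vertex `par v` is the outer vertex from which the
inner vertex `v` was reached, and `rk` increases away from the roots of the search trees. -/
structure SearchInv (M : G.Subgraph) (s : SearchState V) (par : V → V) (rk : V → ℕ) : Prop where
  disjoint : ∀ v ∈ s.outer, v ∉ s.inner
  blossom_outer : ∀ B ∈ s.blossoms, ∀ u ∈ B, u ∈ s.outer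
  laminar : Laminar (s.blossoms : Set (Finset V))
  -- Balance is demanded with respect to the whole family, so that concatenations of such walks are
  -- balanced as well.
  core : ∀ B ∈ s.blossoms, ∃ b ∈ B, (∀ v ∈ B, ¬ M.Adj b v) ∧
    ∀ x ∈ B, ∃ w : G.Walk b x, GoodWalk M s.edges s.blossoms (B : Set V) false w
  free_outer : ∀ v, (∀ u, ¬ M.Adj v u) → v ∈ s.outer
  mate_outer : ∀ u v, M.Adj u v → u ∈ s.outer → v ∈ s.inner ∨ s.top u = s.top v
  mate_inner : ∀ u v, M.Adj u v → u ∈ s.inner → v ∈ s.outer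
  inner_par : ∀ v ∈ s.inner, par v ∈ s.outer ∧ G.Adj (par v) v ∧ ¬ M.Adj (par v) v ∧
    s(par v, v) ∈ s.edges ∧ ∃ v', M.Adj v v' ∧ s(v, v') ∈ s.edges
  edge_cases : ∀ u v, s(u, v) ∈ s.edges → s.top u = s.top v ∨
    (u ∈ s.inner ∧ v ∈ s.outer ∧ (M.Adj u v ∨ v = par u)) ∨
    (v ∈ s.inner ∧ u ∈ s.outer ∧ (M.Adj u v ∨ u = par v))
  -- Ranks take the place of acyclicity of the forest: they separate the pieces of a tree walk and
  -- bound the way up to the root.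
  rk_top : ∀ u v, s.top u = s.top v → rk u = rk v
  rk_par : ∀ v ∈ s.inner, rk (par v) < rk v
  rk_mate : ∀ v ∈ s.inner, ∀ v', M.Adj v v' → rk v < rk v'

/-- `b` is the base of its node: it is not matched inside the node and good walks lead from it to
every vertex of the node. -/
def IsBase (M : G.Subgraph) (s : SearchState V) (b : V) : Prop :=
  (∀ v, s.top v = s.top b → ¬ M.Adj b v) ∧
  ∀ z, s.top z = s.top b → ∃ w : G.Walk b z,
    GoodWalk M s.edges s.blossoms {u | s.top u = s.top b} false w

/-- The chain of nodes that leads from the vertex `x` to the node of `b` towards the root of the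
search tree, without the node of `b`. -/
inductive Ascent (M : G.Subgraph) (s : SearchState V) (par : V → V) (b : V) :
    V → List (Quotient (contraction (s.blossoms : Set (Finset V)))) → Prop
  | base (x : V) : s.top x = s.top b → Ascent M s par b x []
  | step (x a v : V) (ns : List (Quotient (contraction (s.blossoms : Set (Finset V))))) :
      s.top a = s.top x → M.Adj a v → v ∈ s.inner → Ascent M s par b (par v) ns →
      Ascent M s par b x (s.top x :: s.top v :: ns)

/-! ### Bases of nodes and good walks along ascents -/

namespace SearchInv

variable {M : G.Subgraph} {s : SearchState V} {par : V → V} {rk : V → ℕ}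

theorem top_eq_iff (hI : SearchInv M s par rk) {u v : V} :
    s.top u = s.top v ↔ u = v ∨ ∃ B ∈ s.blossoms, u ∈ B ∧ v ∈ B := by
  have := node_eq_iff hI.laminar (u := u) (v := v)
  simpa [SearchState.top] using this

theorem top_eq_of_mem (hI : SearchInv M s par rk) {u v : V} {B : Finset V}
    (hB : B ∈ s.blossoms) (hu : u ∈ B) (hv : v ∈ B) : s.top u = s.top v :=
  hI.top_eq_iff.2 (Or.inr ⟨B, hB, hu, hv⟩)

theorem eq_of_top_eq_inner (hI : SearchInv M s par rk) {u v : V} (h : s.top u = s.top v)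
    (hv : v ∈ s.inner) : u = v := by
  rcases hI.top_eq_iff.1 h with h | ⟨B, hB, -, h2⟩
  · exact h
  · exact absurd hv (hI.disjoint v (hI.blossom_outer B hB v h2))

theorem outer_of_top_eq (hI : SearchInv M s par rk) {u v : V} (h : s.top u = s.top v)
    (hv : v ∈ s.outer) : u ∈ s.outer := by
  rcases hI.top_eq_iff.1 h with rfl | ⟨B, hB, h1, -⟩
  · exact hv
  · exact hI.blossom_outer B hB u h1

theorem top_ne (hI : SearchInv M s par rk) {u v : V} (hu : u ∈ s.outer) (hv : v ∈ s.inner) :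
    s.top u ≠ s.top v := fun h =>
  hI.disjoint u hu (hI.eq_of_top_eq_inner h hv ▸ hv)

theorem exists_isBase (hI : SearchInv M s par rk) (x : V) :
    ∃ b, s.top b = s.top x ∧ IsBase M s b := by
  rcases node_eq_member_or_singleton hI.laminar (Finset.finite_toSet _) x with
    ⟨B, hB, hxB, h⟩ | h
  · obtain ⟨b, hbB, h1, h2⟩ := hI.core B hB
    have htop : ∀ u, s.top u = s.top b ↔ u ∈ B := fun u => by
      rw [show s.top b = s.top x from (h b).2 hbB]
      exact h u
    refine ⟨b, (h b).2 hbB, fun v hv => h1 v ((htop v).1 hv), fun z hz => ?_⟩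
    obtain ⟨w, hw⟩ := h2 z ((htop z).1 hz)
    exact ⟨w, hw.mono subset_rfl fun u hu => (htop u).2 hu⟩
  · have htop : ∀ u, s.top u = s.top x → u = x := fun u => (h u).1
    refine ⟨x, rfl, fun v hv => ?_, fun z hz => ?_⟩
    · rw [htop v hv]
      exact fun h => h.ne rfl
    · rw [htop z hz]
      exact ⟨SimpleGraph.Walk.nil, GoodWalk.nil rfl⟩

/-- A nontrivial good walk from the base ends with a matched edge inside the node, so a vertex
without a mate in the node can only be reached by the trivial walk. -/
theorem eq_base {a b : V} (hb : IsBase M s b) (hab : s.top a = s.top b)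
    (ha : ∀ v, M.Adj a v → s.top v ≠ s.top b) : a = b := by
  by_contra hne
  obtain ⟨w, hw⟩ := hb.2 a hab
  obtain ⟨u, hu, hau⟩ := hw.exists_mate (Ne.symm hne)
  exact ha u hau hu

/-- An inner vertex is a node by itself, so its mate is matched out of its own node. Thus a matched
tree edge always meets the outer node at its base. -/
theorem eq_base_of_inner (hI : SearchInv M s par rk) (hM : M.IsMatching) {a b v : V}
    (hb : IsBase M s b) (hab : s.top a = s.top b) (hav : M.Adj a v) (hv : v ∈ s.inner) :
    a = b := by
  refine eq_base hb hab fun v' hv' => ?_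
  rw [mate_unique hM hv' hav, ← hab]
  exact (hI.top_ne (hI.mate_inner v a hav.symm hv) hv).symm

theorem matched_edge_mem (hI : SearchInv M s par rk) (hM : M.IsMatching) {a v : V}
    (hav : M.Adj v a) (hv : v ∈ s.inner) : s(v, a) ∈ s.edges := by
  obtain ⟨-, -, -, -, v', h1, h2⟩ := hI.inner_par v hv
  rwa [mate_unique hM hav h1]

/-- The nodes of an ascent other than the last have larger rank. -/
theorem rk_lt_of_mem (hI : SearchInv M s par rk) {b x : V}
    {ns : List (Quotient (contraction (s.blossoms : Set (Finset V))))}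
    (h : Ascent M s par b x ns) : rk b ≤ rk x ∧ ∀ u, s.top u ∈ ns → rk b < rk u ∧ rk u ≤ rk x := by
  induction h with
  | base x hx => exact ⟨(hI.rk_top _ _ hx).ge, by simp⟩
  | step x a v ns hax hav hv _ ih =>
    have h1 := hI.rk_par v hv
    have h2 := hI.rk_mate v hv a hav.symm
    have h3 := hI.rk_top _ _ hax
    refine ⟨by omega, fun u hu => ?_⟩
    simp only [List.mem_cons] at hu
    rcases hu with hu | hu | hu
    · have := hI.rk_top _ _ hu
      omega
    · have := hI.rk_top _ _ hu
      omega
    · have := ih.2 u hu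
      omega

/-- The good walk along a matched edge from an inner vertex into the node of its mate. -/
theorem exists_walk_from_inner (hI : SearchInv M s par rk) (hM : M.IsMatching) {a v x : V}
    (hax : s.top a = s.top x) (hav : M.Adj a v) (hv : v ∈ s.inner) :
    ∃ w : G.Walk v x, GoodWalk M s.edges s.blossoms
      {u | s.top u = s.top x ∨ s.top u = s.top v} true w := by
  obtain ⟨b, hbx, hb⟩ := hI.exists_isBase x
  obtain rfl : a = b := hI.eq_base_of_inner hM hb (hax.trans hbx.symm) hav hv
  obtain ⟨w, hw⟩ := hb.2 x hax.symm
  have hao : a ∈ s.outer := hI.mate_inner v a hav.symm hv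
  refine ⟨_, (hw.cons_matched hav.symm (hI.matched_edge_mem hM hav.symm hv)
    (fun B hB h1 h2 => hI.disjoint v (hI.blossom_outer B hB v h1) hv)
    (fun h => hI.top_ne hao hv h.symm)).mono subset_rfl ?_⟩
  rintro u (rfl | hu)
  · exact Or.inr rfl
  · exact Or.inl (hu.trans hax)

theorem not_mem_inner (hI : SearchInv M s par rk) {v : V} (hv : v ∈ s.inner) {B : Finset V}
    (hB : B ∈ s.blossoms) : v ∉ B := fun h => hI.disjoint v (hI.blossom_outer B hB v h) hv

/-- The good walk down the search tree. -/
theorem exists_descent (hI : SearchInv M s par rk) (hM : M.IsMatching) {b x : V}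
    {ns : List (Quotient (contraction (s.blossoms : Set (Finset V))))} (hb : IsBase M s b)
    (h : Ascent M s par b x ns) : ∃ w : G.Walk b x,
      GoodWalk M s.edges s.blossoms {u | s.top u ∈ ns ∨ s.top u = s.top b} false w := by
  induction h with
  | base x hx =>
    obtain ⟨w, hw⟩ := hb.2 x hx
    exact ⟨w, hw.mono subset_rfl fun u hu => Or.inr hu⟩
  | step x a v ns hax hav hv hasc ih =>
    obtain ⟨w, hw⟩ := ih
    obtain ⟨q, hq⟩ := hI.exists_walk_from_inner hM hax hav hv
    obtain ⟨h1, h2, h3, h4, -⟩ := hI.inner_par v hv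
    have hrk := hI.rk_lt_of_mem hasc
    have r1 := hI.rk_par v hv
    have r2 := hI.rk_mate v hv a hav.symm
    have r3 := hI.rk_top _ _ hax
    refine ⟨_, (hw.append_unmatched hq h2 h3 h4 (fun B hB _ => hI.not_mem_inner hv hB)
      ?_).mono subset_rfl ?_⟩
    -- Vertices before the link have rank at most `rk (par v)`, those after it rank at least `rk v`.
    · intro u hu hu'
      have : rk u ≤ rk (par v) := by
        rcases hu with hu | hu
        · exact (hrk.2 u hu).2
        · exact (hI.rk_top _ _ hu).le.trans hrk.1
      rcases hu' with hu' | hu'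
      · have := hI.rk_top _ _ hu'
        omega
      · have := hI.rk_top _ _ hu'
        omega
    · rintro u ((hu | hu) | (hu | hu))
      · exact Or.inl (by simp [hu])
      · exact Or.inr hu
      · exact Or.inl (by simp [hu])
      · exact Or.inl (by simp [hu])

/-- The good walk from an inner vertex down the search tree. -/
theorem exists_descent_from_inner (hI : SearchInv M s par rk) (hM : M.IsMatching) {b x u : V}
    {ns : List (Quotient (contraction (s.blossoms : Set (Finset V))))}
    (h : Ascent M s par b x ns) (hx : x ∈ s.outer) (hu : u ∈ s.inner) (hmem : s.top u ∈ ns) :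
    ∃ w : G.Walk u x, GoodWalk M s.edges s.blossoms {u | s.top u ∈ ns} true w := by
  induction h with
  | base x hx => simp at hmem
  | step x a v ns hax hav hv hasc ih =>
    obtain ⟨q, hq⟩ := hI.exists_walk_from_inner hM hax hav hv
    simp only [List.mem_cons] at hmem
    rcases hmem with hmem | hmem | hmem
    · exact absurd hmem.symm (hI.top_ne hx hu)
    · obtain rfl : u = v := hI.eq_of_top_eq_inner hmem hv
      refine ⟨q, hq.mono subset_rfl ?_⟩
      rintro z (hz | hz) <;> simp [hz]
    · obtain ⟨h1, h2, h3, h4, -⟩ := hI.inner_par v hv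
      obtain ⟨w, hw⟩ := ih h1 hmem
      have hrk := hI.rk_lt_of_mem hasc
      have r1 := hI.rk_par v hv
      have r2 := hI.rk_mate v hv a hav.symm
      have r3 := hI.rk_top _ _ hax
      refine ⟨_, (hw.append_unmatched hq h2 h3 h4 (fun B hB _ => hI.not_mem_inner hv hB)
        ?_).mono subset_rfl ?_⟩
      · intro z hz hz'
        have := (hrk.2 z hz).2
        rcases hz' with hz' | hz'
        · have := hI.rk_top _ _ hz'
          omega
        · have := hI.rk_top _ _ hz'
          omega
      · rintro z (hz | hz | hz)
        · simp [show s.top z ∈ ns from hz]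
        · simp [hz]
        · simp [hz]

/-- An ascent can be started at any outer vertex on it. -/
theorem exists_ascent_of_mem (hI : SearchInv M s par rk) {b x z : V}
    {ns : List (Quotient (contraction (s.blossoms : Set (Finset V))))}
    (h : Ascent M s par b x ns) (hz : z ∈ s.outer) (hmem : s.top z ∈ ns ∨ s.top z = s.top b) :
    ∃ ms ⊆ ns, Ascent M s par b z ms := by
  induction h with
  | base x hx => exact ⟨[], by simp, .base z (by simpa using hmem)⟩
  | step x a v ns hax hav hv hasc ih =>
    by_cases hzx : s.top z = s.top x
    · refine ⟨_, ?_, .step z a v ns (hax.trans hzx.symm) hav hv hasc⟩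
      rw [hzx]
      exact List.Subset.refl _
    · obtain ⟨ms, h1, h2⟩ := ih (by
        rcases hmem with hmem | hmem
        · simp only [List.mem_cons, hzx, hI.top_ne hz hv, false_or] at hmem
          exact Or.inl hmem
        · exact Or.inr hmem)
      exact ⟨ms, fun n hn => by simp [h1 hn], h2⟩

/-- The neighbours of an inner vertex on an ascent lie on the ascent. -/
theorem mem_of_inner_mem (hI : SearchInv M s par rk) (hM : M.IsMatching) {b x u : V}
    {ns : List (Quotient (contraction (s.blossoms : Set (Finset V))))}
    (h : Ascent M s par b x ns) (hx : x ∈ s.outer) (hu : u ∈ s.inner) (hmem : s.top u ∈ ns) :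
    (s.top (par u) ∈ ns ∨ s.top (par u) = s.top b) ∧ ∀ v, M.Adj u v → s.top v ∈ ns := by
  induction h with
  | base x hx => simp at hmem
  | step x a v ns hax hav hv hasc ih =>
    simp only [List.mem_cons] at hmem
    rcases hmem with hmem | hmem | hmem
    · exact absurd hmem.symm (hI.top_ne hx hu)
    · obtain rfl : u = v := hI.eq_of_top_eq_inner hmem hv
      refine ⟨?_, fun v huv => ?_⟩
      · cases hasc with
        | base _ h => exact Or.inr h
        | step => exact Or.inl (by simp)
      · rw [mate_unique hM huv hav.symm, hax]
        simp
    · obtain ⟨h1, h2⟩ := ih (hI.inner_par v hv).1 hmem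
      exact ⟨h1.imp_left fun h => by simp [h], fun v huv => by simp [h2 v huv]⟩

end SearchInv

/-! ### Paths in the contracted search structure -/

namespace Ascent

variable {M : G.Subgraph} {s : SearchState V} {par : V → V} {b x : V}
  {ns : List (Quotient (contraction (s.blossoms : Set (Finset V))))}

theorem congr_start (h : Ascent M s par b x ns) {y : V} (hy : s.top y = s.top x) :
    Ascent M s par b y ns := by
  cases h with
  | base _ h => exact .base y (hy.trans h)
  | step _ a v ns ha hav hv h => exact hy ▸ .step y a v ns (ha.trans hy.symm) hav hv h

theorem congr_end (h : Ascent M s par b x ns) {c : V} (hc : s.top b = s.top c) :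
    Ascent M s par c x ns := by
  induction h with
  | base _ h => exact .base _ (h.trans hc)
  | step _ a v ns ha hav hv _ ih => exact .step _ a v ns ha hav hv ih

theorem trans (h : Ascent M s par b x ns) {c : V}
    {ms : List (Quotient (contraction (s.blossoms : Set (Finset V))))}
    (h' : Ascent M s par c b ms) : Ascent M s par c x (ns ++ ms) := by
  induction h with
  | base _ h => exact h'.congr_start h
  | step _ a v ns ha hav hv _ ih => exact .step _ a v (ns ++ ms) ha hav hv ih

theorem end_outer {rk : V → ℕ} (h : Ascent M s par b x ns) (hI : SearchInv M s par rk)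
    (hx : x ∈ s.outer) : b ∈ s.outer := by
  induction h with
  | base _ h => exact hI.outer_of_top_eq h.symm hx
  | step _ a v ns ha hav hv _ ih => exact ih (hI.inner_par v hv).1

end Ascent

/-! ### Forest paths between outer nodes as pairs of ascents -/

namespace SearchInv

variable {M : G.Subgraph} {s : SearchState V} {par : V → V} {rk : V → ℕ}

theorem forest_adj {X Y : Quotient (contraction (s.blossoms : Set (Finset V)))}
    (h : s.forest.Adj X Y) : X ≠ Y ∧ ∃ u w, s(u, w) ∈ s.edges ∧ s.top u = X ∧ s.top w = Y := by
  unfold SearchState.forest at h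
  rw [SimpleGraph.fromRel_adj] at h
  obtain ⟨hne, ⟨u, w, h, h1, h2⟩ | ⟨u, w, h, h1, h2⟩⟩ := h
  · exact ⟨hne, u, w, h, h1, h2⟩
  · exact ⟨hne, w, u, by rwa [Sym2.eq_swap], h2, h1⟩

theorem forest_adj_outer (hI : SearchInv M s par rk) {x : V} (hx : x ∈ s.outer)
    {Y : Quotient (contraction (s.blossoms : Set (Finset V)))} (h : s.forest.Adj (s.top x) Y) :
    ∃ u w, s.top u = s.top x ∧ w ∈ s.inner ∧ s.top w = Y ∧ (M.Adj u w ∨ u = par w) := by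
  obtain ⟨hne, u, w, he, hu, hw⟩ := forest_adj h
  rcases hI.edge_cases u w he with h | ⟨h1, -, -⟩ | ⟨h1, h2, h3⟩
  · exact absurd (hu.symm.trans (h.trans hw)) hne
  · exact absurd hu.symm (hI.top_ne hx h1)
  · exact ⟨u, w, hu, h1, hw, h3⟩

theorem forest_adj_inner (hI : SearchInv M s par rk) {w : V} (hw : w ∈ s.inner)
    {Y : Quotient (contraction (s.blossoms : Set (Finset V)))} (h : s.forest.Adj (s.top w) Y) :
    Y = s.top (par w) ∨ ∃ a, M.Adj a w ∧ Y = s.top a := by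
  obtain ⟨hne, u, v, he, hu, hv⟩ := forest_adj h
  obtain rfl := hI.eq_of_top_eq_inner hu hw
  rcases hI.edge_cases u v he with h | ⟨h1, h2, h3⟩ | ⟨h1, h2, h3⟩
  · exact absurd (hu.symm.trans (h.trans hv)) hne
  · rcases h3 with h3 | rfl
    · exact Or.inr ⟨v, h3.symm, hv.symm⟩
    · exact Or.inl hv.symm
  · exact absurd hw (hI.disjoint u h2)

/-- A path of the forest that starts with an edge away from the root keeps leading away from the
root. -/
theorem exists_ascent_of_descending (hI : SearchInv M s par rk) (hM : M.IsMatching) (n : ℕ) :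
    ∀ {X Y : Quotient (contraction (s.blossoms : Set (Finset V)))} (p : s.forest.Walk X Y),
      p.length ≤ n → p.IsPath → ∀ w ∈ s.inner, ∀ y ∈ s.outer, s.top w = X → s.top y = Y →
      s.top (par w) ∉ p.support →
      ∃ ns, Ascent M s par (par w) y ns ∧ p.support = ns.reverse := by
  induction n using Nat.strong_induction_on with
  | _ n ih =>
  intro X Y p hn hp w hw y hy hX hY hpar
  cases p with
  | nil => exact absurd (hY.trans hX.symm) (hI.top_ne hy hw)
  | cons h q =>
    subst hX
    rw [SimpleGraph.Walk.cons_isPath_iff] at hp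
    rcases hI.forest_adj_inner hw h with rfl | ⟨a, haw, rfl⟩
    · exact absurd (by simp) hpar
    · have hao := hI.mate_inner w a haw.symm hw
      cases q with
      | nil =>
        refine ⟨[s.top y, s.top w], .step y a w [] hY.symm haw hw (.base _ rfl), ?_⟩
        simp [hY]
      | cons h' q' =>
        rw [SimpleGraph.Walk.cons_isPath_iff] at hp
        obtain ⟨u, w', hu, hw', rfl, hcase⟩ := hI.forest_adj_outer hao h'
        have hne : s.top w' ≠ s.top w := by
          intro heq
          apply hp.2
          rw [← heq]
          simp
        rcases hcase with huw | rfl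
        -- Both matched edges leave the node of `a` at its unique base, so they coincide and the
        -- path would return to `w`.
        · exfalso
          obtain ⟨b, hb, hbase⟩ := hI.exists_isBase a
          have h1 := hI.eq_base_of_inner hM hbase (hu.trans hb.symm) huw hw'
          have h2 := hI.eq_base_of_inner hM hbase hb.symm haw hw
          subst h1
          subst h2
          exact hne (by rw [mate_unique hM huw haw])
        · obtain ⟨ns, h1, h2⟩ := ih q'.length (by simp at hn; omega) q' le_rfl hp.1.1 w' hw' y hy
            rfl hY (by rw [hu]; exact hp.1.2)
          refine ⟨ns ++ [s.top a, s.top w], h1.trans ?_, by simp [h2]⟩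
          exact (Ascent.step a a w [] rfl haw hw (.base _ rfl)).congr_start hu

/-- A path of the forest between outer nodes goes towards the root and then away from it. -/
theorem exists_ascents (hI : SearchInv M s par rk) (hM : M.IsMatching) (n : ℕ) :
    ∀ {X Y : Quotient (contraction (s.blossoms : Set (Finset V)))} (p : s.forest.Walk X Y),
      p.length ≤ n → p.IsPath → ∀ x ∈ s.outer, ∀ y ∈ s.outer, s.top x = X → s.top y = Y →
      ∃ b ns ms, Ascent M s par b x ns ∧ Ascent M s par b y ms ∧
        p.support = ns ++ s.top b :: ms.reverse := by
  induction n using Nat.strong_induction_on with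
  | _ n ih =>
  intro X Y p hn hp x hx y hy hX hY
  cases p with
  | nil => exact ⟨x, [], [], .base x rfl, .base y (hY.trans hX.symm), by simp [hX]⟩
  | cons h q =>
    subst hX
    rw [SimpleGraph.Walk.cons_isPath_iff] at hp
    obtain ⟨u, w, hu, hw, rfl, hcase⟩ := hI.forest_adj_outer hx h
    rcases hcase with huw | rfl
    · cases q with
      | nil => exact absurd hY (hI.top_ne hy hw)
      | cons h' q' =>
        rw [SimpleGraph.Walk.cons_isPath_iff] at hp
        rcases hI.forest_adj_inner hw h' with rfl | ⟨a, haw, rfl⟩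
        · obtain ⟨b, ns, ms, h1, h2, h3⟩ := ih q'.length (by simp at hn; omega) q' le_rfl hp.1.1
            (par w) (hI.inner_par w hw).1 y hy rfl hY
          exact ⟨b, _, ms, .step x u w ns hu huw hw h1, h2, by simp [h3]⟩
        -- The only other neighbour of `w` is the node of its mate, which the path has just left.
        · exfalso
          apply hp.2
          obtain rfl := mate_unique hM haw.symm huw.symm
          rw [← hu]
          simp
    · obtain ⟨ms, h1, h2⟩ := hI.exists_ascent_of_descending hM _ q le_rfl hp.1 w hw y hy rfl hY
        (by rw [hu]; exact hp.2)
      refine ⟨x, [], ms, .base x rfl, h1.congr_end hu, by simp [h2]⟩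

end SearchInv

/-! ### Preservation of the structural invariant -/

/-- An even alternating walk has defect 0 in any set that contains it, and a walk that misses a set
has defect 0 there. A new blossom contains or misses each older one, so old walks stay good. -/
theorem GoodWalk.insert {M : G.Subgraph} {E : Set (Sym2 V)} {F : Finset (Finset V)} {S : Set V}
    {a b : V} {w : G.Walk a b} (h : GoodWalk M E F S false w) {B : Finset V}
    (hB : (∀ u ∈ S, u ∈ B) ∨ ∀ u ∈ S, u ∉ B) : GoodWalk M E (insert B F) S false w := by
  refine { h with balanced := fun C hC => ?_ }
  rw [Finset.mem_insert] at hC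
  rcases hC with rfl | hC
  · have hmem : ∀ e ∈ w.edges, ∀ u ∈ e, u ∈ S := by
      intro e he u hu
      induction e with
      | _ p q =>
        rw [Sym2.mem_iff] at hu
        rcases hu with rfl | rfl
        · exact h.support_subset _ (w.fst_mem_support_of_mem_edges he)
        · exact h.support_subset _ (w.snd_mem_support_of_mem_edges he)
    rcases hB with hB | hB
    · rw [h.alt.defect_eq fun e he u hu => hB u (hmem e he u hu),
        SimpleGraph.Walk.length_edges, if_pos (h.even_iff.2 rfl)]
    · refine defect_eq_zero fun e he hin => ?_
      induction e with
      | _ p q => exact hB p (hmem _ he p (by simp)) (hin p (by simp))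
  · exact h.balanced C hC

/-- Assuming laminarity alone, this applies to the state after a blossom step before its full
invariant is known. -/
theorem SearchState.top_eq_iff {s : SearchState V} (h : Laminar (s.blossoms : Set (Finset V)))
    {u v : V} : s.top u = s.top v ↔ u = v ∨ ∃ B ∈ s.blossoms, u ∈ B ∧ v ∈ B := by
  have := node_eq_iff h (u := u) (v := v)
  simpa [SearchState.top] using this

/-! ### Blossom steps -/

namespace SearchInv

variable {M : G.Subgraph} {s : SearchState V} {par : V → V} {rk : V → ℕ}

theorem not_adj_of_outer (hI : SearchInv M s par rk) {x v : V} (hx : x ∈ s.outer)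
    (hv : v ∈ s.outer) (hne : s.top x ≠ s.top v) : ¬ M.Adj x v := fun h =>
  (hI.mate_outer x v h hx).elim (hI.disjoint v hv) hne

/-- The walk around the new blossom to an inner vertex of the fundamental cycle. -/
theorem exists_walk_around (hI : SearchInv M s par rk) (hM : M.IsMatching) {b x v u : V}
    {ns ms : List (Quotient (contraction (s.blossoms : Set (Finset V))))}
    (hadj : G.Adj x v) (hx : x ∈ s.outer) (hv : v ∈ s.outer) (hne : s.top x ≠ s.top v)
    (hb : IsBase M s b) (hns : Ascent M s par b x ns) (hms : Ascent M s par b v ms)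
    (hdisj : ∀ X ∈ ns, X ∉ ms ∧ X ≠ s.top b) (hu : u ∈ s.inner) (hmem : s.top u ∈ ns) :
    ∃ w : G.Walk b u, GoodWalk M (s.edges ∪ {s(x, v)}) s.blossoms
      {u | s.top u ∈ ns ∨ s.top u = s.top b ∨ s.top u ∈ ms} false w := by
  obtain ⟨w, hw⟩ := hI.exists_descent hM hb hms
  obtain ⟨q, hq⟩ := hI.exists_descent_from_inner hM hns hx hu hmem
  refine ⟨_, ((hw.mono (E' := s.edges ∪ {s(x, v)}) (by simp) subset_rfl).append_unmatched
    (hq.reverse.mono (E' := s.edges ∪ {s(x, v)}) (by simp) subset_rfl) hadj.symm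
    (hI.not_adj_of_outer hv hx hne.symm) (by simp [Sym2.eq_swap])
    (fun B hB h1 h2 => hne (hI.top_eq_of_mem hB h2 h1)) ?_).mono subset_rfl ?_⟩
  · intro z hz hz'
    rcases hz with hz | hz
    · exact (hdisj _ hz').1 hz
    · exact (hdisj _ hz').2 hz
  · rintro z ((hz | hz) | hz)
    · exact Or.inr (Or.inr hz)
    · exact Or.inr (Or.inl hz)
    · exact Or.inl hz

/-- The fundamental cycle consists of two ascents `ns` and `ms` to a common outer node, whose base
becomes the base of the new blossom. Outer vertices of the cycle are reached by descending on their
own side; inner ones by descending on the other side, crossing `xv` and climbing back up. -/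
theorem shrink (hI : SearchInv M s par rk) (hM : M.IsMatching) {x v : V} {B : Finset V}
    (p : s.forest.Walk (s.top x) (s.top v)) (hadj : G.Adj x v) (hx : x ∈ s.outer)
    (hne : s.top x ≠ s.top v) (hv : v ∈ s.outer) (hp : p.IsPath)
    (hB : ∀ u, u ∈ B ↔ s.top u ∈ p.support) :
    ∃ rk', SearchInv M (s.shrink x v B) par rk' := by
  obtain ⟨b', ns, ms, hns, hms, hsupp⟩ := hI.exists_ascents hM _ p le_rfl hp x hx v hv rfl rfl
  -- The ascents end at an arbitrary vertex of the top node; good walks have to start at its base.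
  obtain ⟨b, hbb', hb⟩ := hI.exists_isBase b'
  replace hns := hns.congr_end hbb'.symm
  replace hms := hms.congr_end hbb'.symm
  rw [← hbb'] at hsupp
  replace hB : ∀ u, u ∈ B ↔ (s.top u ∈ ns ∨ s.top u = s.top b ∨ s.top u ∈ ms) := fun u => by
    rw [hB u, hsupp]
    simp
  have hnodup := hp.support_nodup
  rw [hsupp, List.nodup_append, List.nodup_cons] at hnodup
  obtain ⟨-, ⟨hbms, -⟩, hdis⟩ := hnodup
  simp only [List.mem_reverse, List.mem_cons, ne_eq] at hbms hdis
  have hdisj : ∀ X ∈ ns, X ∉ ms ∧ X ≠ s.top b := fun X hX =>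
    ⟨fun h => hdis X hX X (Or.inr h) rfl, fun h => hdis X hX _ (Or.inl rfl) h⟩
  have hdisj' : ∀ X ∈ ms, X ∉ ns ∧ X ≠ s.top b := fun X hX =>
    ⟨fun h => (hdisj X h).1 hX, fun h => hbms (h ▸ hX)⟩
  have hbo : b ∈ s.outer := hns.end_outer hI hx
  have hbB : b ∈ B := (hB b).2 (Or.inr (Or.inl rfl))
  have hclosed : ∀ u w, s.top u = s.top w → u ∈ B → w ∈ B := fun u w h hu => by
    rw [hB, ← h, ← hB]
    exact hu
  have hmeet : ∀ C ∈ s.blossoms, ∀ u ∈ C, u ∈ B → C ⊆ B := fun C hC u huC huB w hw =>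
    hclosed u w (hI.top_eq_of_mem hC huC hw) huB
  have hlam : Laminar ((insert B s.blossoms : Finset (Finset V)) : Set (Finset V)) := by
    intro C hC D hD u huC huD
    rw [Finset.mem_coe, Finset.mem_insert] at hC hD
    rcases hC with rfl | hC <;> rcases hD with rfl | hD
    · exact Or.inl subset_rfl
    · exact Or.inr (hmeet D hD u huD huC)
    · exact Or.inl (hmeet C hC u huC huD)
    · exact hI.laminar C hC D hD u huC huD
  have htop : ∀ u w, (s.shrink x v B).top u = (s.shrink x v B).top w ↔
      s.top u = s.top w ∨ (u ∈ B ∧ w ∈ B) := by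
    intro u w
    rw [SearchState.top_eq_iff (s := s.shrink x v B) hlam, hI.top_eq_iff]
    change (_ ∨ ∃ C ∈ insert B s.blossoms, _) ↔ _
    simp only [Finset.mem_insert]
    constructor
    · rintro (h | ⟨C, rfl | hC, h⟩)
      · exact Or.inl (Or.inl h)
      · exact Or.inr h
      · exact Or.inl (Or.inr ⟨C, hC, h⟩)
    · rintro ((h | ⟨C, hC, h⟩) | h)
      · exact Or.inl h
      · exact Or.inr ⟨C, Or.inr hC, h⟩
      · exact Or.inr ⟨B, Or.inl rfl, h⟩
  have hrkns := hI.rk_lt_of_mem hns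
  have hrkms := hI.rk_lt_of_mem hms
  have hrkB : ∀ u ∈ B, rk b ≤ rk u := by
    intro u hu
    rcases (hB u).1 hu with h | h | h
    · exact (hrkns.2 u h).1.le
    · exact (hI.rk_top _ _ h).ge
    · exact (hrkms.2 u h).1.le
  have hinnerB : ∀ u ∈ s.inner, u ∈ B → par u ∈ B ∧ ∀ w, M.Adj u w → w ∈ B := by
    intro u hu huB
    rcases (hB u).1 huB with h | h | h
    · obtain ⟨h1, h2⟩ := hI.mem_of_inner_mem hM hns hx hu h
      exact ⟨(hB _).2 (h1.imp_right Or.inl), fun w hw => (hB w).2 (Or.inl (h2 w hw))⟩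
    · exact absurd h.symm (hI.top_ne hbo hu)
    · obtain ⟨h1, h2⟩ := hI.mem_of_inner_mem hM hms hv hu h
      refine ⟨(hB _).2 ?_, fun w hw => (hB w).2 (Or.inr (Or.inr (h2 w hw)))⟩
      rcases h1 with h1 | h1
      · exact Or.inr (Or.inr h1)
      · exact Or.inr (Or.inl h1)
  have hBlab : ∀ u ∈ B, u ∈ s.outer ∨ u ∈ s.inner := by
    intro u hu
    have key : ∀ {y : V} {l}, Ascent M s par b y l → y ∈ s.outer → s.top u ∈ l →
        u ∈ s.outer ∨ u ∈ s.inner := by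
      intro y l hl hy hul
      induction hl with
      | base => simp at hul
      | step y a w l _ _ hw _ ih =>
        simp only [List.mem_cons] at hul
        rcases hul with h | h | h
        · exact Or.inl (hI.outer_of_top_eq h hy)
        · exact Or.inr (hI.eq_of_top_eq_inner h hw ▸ hw)
        · exact ih (hI.inner_par w hw).1 h
    rcases (hB u).1 hu with h | h | h
    · exact key hns hx h
    · exact Or.inl (hI.outer_of_top_eq h hbo)
    · exact key hms hv h
  have hsub : s.edges ⊆ s.edges ∪ {s(x, v)} := Set.subset_union_left
  -- The whole blossom takes the rank of its top node, the least rank on the cycle, so ranks only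
  -- drop and stay constant on nodes.
  refine ⟨fun u => if u ∈ B then rk b else rk u, ?_⟩
  refine
    { disjoint := ?_
      blossom_outer := ?_
      laminar := hlam
      core := ?_
      free_outer := fun u hu => Or.inl (hI.free_outer u hu)
      mate_outer := ?_
      mate_inner := ?_
      inner_par := ?_
      edge_cases := ?_
      rk_top := ?_
      rk_par := ?_
      rk_mate := ?_ }
  · rintro u (hu | hu) ⟨h1, h2⟩
    · exact hI.disjoint u hu h1
    · exact h2 hu
  · intro C hC u hu
    change C ∈ insert B s.blossoms at hC
    rw [Finset.mem_insert] at hC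
    rcases hC with rfl | hC
    · exact Or.inr hu
    · exact Or.inl (hI.blossom_outer C hC u hu)
  · intro C hC
    change C ∈ insert B s.blossoms at hC
    rw [Finset.mem_insert] at hC
    rcases hC with rfl | hC
    · refine ⟨b, hbB, fun w hw hbw => ?_, fun z hz => ?_⟩
      -- An inner mate of the base would have rank below `rk b`, but no vertex of the cycle does.
      · rcases hI.mate_outer b w hbw hbo with h | h
        · have := hI.rk_mate w h b hbw.symm
          have := hrkB w hw
          omega
        · exact hb.1 w h.symm hbw
      · have hdesc : ∀ {y : V} {l}, Ascent M s par b y l → z ∈ s.outer →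
            (s.top z ∈ l ∨ s.top z = s.top b) → (∀ u, s.top u ∈ l → u ∈ C) →
            ∃ w : G.Walk b z, GoodWalk M (s.edges ∪ {s(x, v)}) s.blossoms (C : Set V) false w := by
          intro y l hl hzo hzl hlC
          obtain ⟨l', hl', hasc⟩ := hI.exists_ascent_of_mem hl hzo hzl
          obtain ⟨w, hw⟩ := hI.exists_descent hM hb hasc
          refine ⟨w, hw.mono hsub ?_⟩
          rintro u (hu | hu)
          · exact hlC u (hl' hu)
          · exact (hB u).2 (Or.inr (Or.inl hu))
        obtain ⟨w, hw⟩ : ∃ w : G.Walk b z,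
            GoodWalk M (s.edges ∪ {s(x, v)}) s.blossoms (C : Set V) false w := by
          have hsubns : ∀ u, s.top u ∈ ns → u ∈ C := fun u hu => (hB u).2 (Or.inl hu)
          have hsubms : ∀ u, s.top u ∈ ms → u ∈ C := fun u hu => (hB u).2 (Or.inr (Or.inr hu))
          rcases hBlab z hz with hzo | hzi
          · rcases (hB z).1 hz with h | h | h
            · exact hdesc hns hzo (Or.inl h) hsubns
            · exact hdesc hns hzo (Or.inr h) hsubns
            · exact hdesc hms hzo (Or.inl h) hsubms
          · rcases (hB z).1 hz with h | h | h
            · obtain ⟨w, hw⟩ := hI.exists_walk_around hM hadj hx hv hne hb hns hms hdisj hzi h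
              exact ⟨w, hw.mono subset_rfl fun u hu => (hB u).2 hu⟩
            · exact absurd h.symm (hI.top_ne hbo hzi)
            · obtain ⟨w, hw⟩ := hI.exists_walk_around hM hadj.symm hv hx hne.symm hb hms hns
                hdisj' hzi h
              refine ⟨w, hw.mono (by rw [Sym2.eq_swap]) ?_⟩
              rintro u (h | h | h)
              · exact hsubms u h
              · exact (hB u).2 (Or.inr (Or.inl h))
              · exact hsubns u h
        exact ⟨w, hw.insert (Or.inl fun u hu => hu)⟩
    · obtain ⟨c, hcC, h1, h2⟩ := hI.core C hC
      refine ⟨c, hcC, h1, fun z hz => ?_⟩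
      obtain ⟨w, hw⟩ := h2 z hz
      refine ⟨w, (hw.mono hsub subset_rfl).insert ?_⟩
      by_cases h : ∃ u ∈ C, u ∈ B
      · obtain ⟨u, hu1, hu2⟩ := h
        exact Or.inl fun w hw => hmeet C hC u hu1 hu2 hw
      · push Not at h
        exact Or.inr h
  · intro u w huw hu
    rw [htop]
    have hin : w ∈ s.inner → w ∈ (s.shrink x v B).inner ∨ s.top u = s.top w ∨ u ∈ B ∧ w ∈ B := by
      intro hw
      by_cases hwB : w ∈ B
      · exact Or.inr (Or.inr ⟨(hinnerB w hw hwB).2 u huw.symm, hwB⟩)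
      · exact Or.inl ⟨hw, hwB⟩
    have hout : u ∈ s.outer → w ∈ (s.shrink x v B).inner ∨ s.top u = s.top w ∨ u ∈ B ∧ w ∈ B := by
      intro hu
      rcases hI.mate_outer u w huw hu with h | h
      · exact hin h
      · exact Or.inr (Or.inl h)
    rcases hu with hu | hu
    · exact hout hu
    · rcases hBlab u hu with h | h
      · exact hout h
      · exact Or.inr (Or.inr ⟨hu, (hinnerB u h hu).2 w huw⟩)
  · rintro u w huw ⟨hu, -⟩
    exact Or.inl (hI.mate_inner u w huw hu)
  · rintro u ⟨hu, -⟩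
    obtain ⟨h1, h2, h3, h4, u', h5, h6⟩ := hI.inner_par u hu
    exact ⟨Or.inl h1, h2, h3, Or.inl h4, u', h5, Or.inl h6⟩
  · rintro u w (he | he)
    · rw [htop]
      have key : ∀ u w, u ∈ s.inner → w ∈ s.outer → (M.Adj u w ∨ w = par u) →
          (u ∈ B ∧ w ∈ B) ∨ (u ∈ (s.shrink x v B).inner ∧ w ∈ (s.shrink x v B).outer) := by
        intro u w hu hw h
        by_cases huB : u ∈ B
        · refine Or.inl ⟨huB, ?_⟩
          rcases h with h | rfl
          · exact (hinnerB u hu huB).2 w h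
          · exact (hinnerB u hu huB).1
        · exact Or.inr ⟨⟨hu, huB⟩, Or.inl hw⟩
      rcases hI.edge_cases u w he with h | ⟨h1, h2, h3⟩ | ⟨h1, h2, h3⟩
      · exact Or.inl (Or.inl h)
      · rcases key u w h1 h2 h3 with h | ⟨h, h'⟩
        · exact Or.inl (Or.inr h)
        · exact Or.inr (Or.inl ⟨h, h', h3⟩)
      · rcases key w u h1 h2 (h3.imp_left fun h => h.symm) with h | ⟨h, h'⟩
        · exact Or.inl (Or.inr h.symm)
        · exact Or.inr (Or.inr ⟨h, h', h3⟩)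
    · left
      rw [htop]
      right
      have hxB : x ∈ B := by
        rw [hB]
        cases hns with
        | base _ h => exact Or.inr (Or.inl h)
        | step => simp
      have hvB : v ∈ B := by
        rw [hB]
        cases hms with
        | base _ h => exact Or.inr (Or.inl h)
        | step => simp
      rw [Set.mem_singleton_iff, Sym2.eq_iff] at he
      rcases he with ⟨rfl, rfl⟩ | ⟨rfl, rfl⟩
      · exact ⟨hxB, hvB⟩
      · exact ⟨hvB, hxB⟩
  · intro u w huw
    rw [htop] at huw
    rcases huw with h | ⟨h1, h2⟩
    · have : u ∈ B ↔ w ∈ B := ⟨hclosed u w h, hclosed w u h.symm⟩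
      simp only [this, hI.rk_top u w h]
    · simp [h1, h2]
  · rintro u ⟨hu, huB⟩
    replace huB : u ∉ B := huB
    have h1 := hI.rk_par u hu
    simp only [huB, if_false]
    split_ifs with h
    · have := hrkB _ h
      omega
    · exact h1
  · rintro u ⟨hu, huB⟩ w huw
    replace huB : u ∉ B := huB
    have h1 := hI.rk_mate u hu w huw
    simp only [huB, if_false]
    split_ifs with h
    -- If the mate `w` of `u` lay on the cycle below the top node, then `u` would be on the cycle
    -- too. So `w` is in the top node, whose rank has not changed.
    · have hwo := hI.mate_inner u w huw hu
      have key : ∀ {y : V} {l}, Ascent M s par b y l → y ∈ s.outer → s.top w ∈ l →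
          s.top u ∈ l := by
        intro y l hl hy hul
        induction hl with
        | base => simp at hul
        | step y a c l hay hac hc _ ih =>
          simp only [List.mem_cons] at hul
          rcases hul with h | h | h
          · obtain ⟨d, hd, hdb⟩ := hI.exists_isBase y
            have e1 := hI.eq_base_of_inner hM hdb (hay.trans hd.symm) hac hc
            have e2 := hI.eq_base_of_inner hM hdb (h.trans hd.symm) huw.symm hu
            subst e1
            subst e2
            rw [mate_unique hM huw.symm hac]
            simp
          · exact absurd h (hI.top_ne hwo hc)
          · simp [ih (hI.inner_par c hc).1 h]
      rcases (hB w).1 h with h' | h' | h'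
      · exact absurd ((hB u).2 (Or.inl (key hns hx h'))) huB
      · rwa [← hI.rk_top _ _ h']
      · exact absurd ((hB u).2 (Or.inr (Or.inr (key hms hv h')))) huB
    · exact h1

end SearchInv

/-! ### Initial state, dual adjustments, grow steps and ascents to the roots -/

namespace SearchInv

variable {M : G.Subgraph} {s : SearchState V} {par : V → V} {rk : V → ℕ}

theorem initial : SearchInv M (SearchState.initial M) id (fun _ => 0) where
  disjoint _ _ h := h
  blossom_outer B hB := by simp [SearchState.initial] at hB
  laminar B hB := by simp [SearchState.initial] at hB
  core B hB := by simp [SearchState.initial] at hB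
  free_outer v hv := isFree_ofSimpleGraph_iff.2 hv
  mate_outer u v huv hu := absurd huv (isFree_ofSimpleGraph_iff.1 hu v)
  mate_inner u v _ hu := absurd hu id
  inner_par v hv := absurd hv id
  edge_cases u v h := absurd h id
  rk_top _ _ _ := rfl
  rk_par v hv := absurd hv id
  rk_mate v hv := absurd hv id

theorem adjust (hI : SearchInv M s par rk) (δ : ℝ) : SearchInv M (s.adjust δ) par rk :=
  { hI with }

/-- The mate `v'` is outside the search structure as well, since the mate of a vertex of the
structure belongs to it. Vertices outside are nodes by themselves, so the new vertices can receive
the ranks `rk x + 1` and `rk x + 2` without affecting others. -/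
theorem grow (hI : SearchInv M s par rk) (hM : M.IsMatching) {x v v' : V}
    (hadj : G.Adj x v) (hx : x ∈ s.outer) (hv : v ∉ s.outer ∪ s.inner) (hvv' : M.Adj v v') :
    ∃ par' rk', SearchInv M (s.grow x v v') par' rk' := by
  rw [Set.mem_union, not_or] at hv
  obtain ⟨hvo, hvi⟩ := hv
  have hvo' : v' ∉ s.outer := fun h =>
    (hI.mate_outer v' v hvv'.symm h).elim hvi fun h' => hvo (hI.outer_of_top_eq h'.symm h)
  have hvi' : v' ∉ s.inner := fun h => hvo (hI.mate_inner v' v hvv'.symm h)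
  have hne : v ≠ v' := hvv'.ne
  have hxv : x ≠ v := hadj.ne
  have hxv' : x ≠ v' := fun h => hvo' (h ▸ hx)
  have hxM : ¬ M.Adj x v := fun h =>
    (hI.mate_outer x v h hx).elim hvi fun h' => hvo (hI.outer_of_top_eq h'.symm hx)
  have hsing : ∀ u w, s.top u = s.top w → w ∉ s.outer → u = w := by
    intro u w h hw
    rcases hI.top_eq_iff.1 h with h | ⟨B, hB, -, h2⟩
    · exact h
    · exact absurd (hI.blossom_outer B hB w h2) hw
  have hsub : s.edges ⊆ s.edges ∪ {s(x, v), s(v, v')} := Set.subset_union_left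
  have hio : ∀ u ∈ s.outer, u ≠ v ∧ u ≠ v' := fun u hu =>
    ⟨fun h => hvo (h ▸ hu), fun h => hvo' (h ▸ hu)⟩
  have hii : ∀ u ∈ s.inner, u ≠ v ∧ u ≠ v' := fun u hu =>
    ⟨fun h => hvi (h ▸ hu), fun h => hvi' (h ▸ hu)⟩
  refine ⟨Function.update par v x,
    fun u => if u = v then rk x + 1 else if u = v' then rk x + 2 else rk u, ?_⟩
  refine
    { disjoint := ?_
      blossom_outer := fun B hB u hu => Or.inl (hI.blossom_outer B hB u hu)
      laminar := hI.laminar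
      core := ?_
      free_outer := fun u hu => Or.inl (hI.free_outer u hu)
      mate_outer := ?_
      mate_inner := ?_
      inner_par := ?_
      edge_cases := ?_
      rk_top := ?_
      rk_par := ?_
      rk_mate := ?_ }
  · rintro u (hu | rfl) (hu' | rfl)
    · exact hI.disjoint u hu hu'
    · exact hvo hu
    · exact hvi' hu'
    · exact hne rfl
  · intro B hB
    obtain ⟨b, hb, h1, h2⟩ := hI.core B hB
    refine ⟨b, hb, h1, fun z hz => ?_⟩
    obtain ⟨w, hw⟩ := h2 z hz
    exact ⟨w, hw.mono hsub subset_rfl⟩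
  · rintro u w huw (hu | rfl)
    · rcases hI.mate_outer u w huw hu with h | h
      · exact Or.inl (Or.inl h)
      · exact Or.inr h
    · exact Or.inl (Or.inr (mate_unique hM huw hvv'.symm))
  · rintro u w huw (hu | rfl)
    · exact Or.inl (hI.mate_inner u w huw hu)
    · exact Or.inr (mate_unique hM huw hvv')
  · rintro u (hu | rfl)
    · rw [Function.update_of_ne (hii u hu).1]
      obtain ⟨h1, h2, h3, h4, u', h5, h6⟩ := hI.inner_par u hu
      exact ⟨Or.inl h1, h2, h3, Or.inl h4, u', h5, Or.inl h6⟩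
    · rw [Function.update_self]
      exact ⟨Or.inl hx, hadj, hxM, Or.inr (by simp), v', hvv', Or.inr (by simp)⟩
  · rintro u w (he | he)
    · rcases hI.edge_cases u w he with h | ⟨h1, h2, h3⟩ | ⟨h1, h2, h3⟩
      · exact Or.inl h
      · refine Or.inr (Or.inl ⟨Or.inl h1, Or.inl h2, ?_⟩)
        rwa [Function.update_of_ne (hii u h1).1]
      · refine Or.inr (Or.inr ⟨Or.inl h1, Or.inl h2, ?_⟩)
        rwa [Function.update_of_ne (hii w h1).1]
    · right
      rw [Set.mem_insert_iff, Set.mem_singleton_iff, Sym2.eq_iff, Sym2.eq_iff] at he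
      rcases he with (⟨rfl, rfl⟩ | ⟨rfl, rfl⟩) | (⟨rfl, rfl⟩ | ⟨rfl, rfl⟩)
      · exact Or.inr ⟨Or.inr rfl, Or.inl hx, Or.inr (by simp)⟩
      · exact Or.inl ⟨Or.inr rfl, Or.inl hx, Or.inr (by simp)⟩
      · exact Or.inl ⟨Or.inr rfl, Or.inr rfl, Or.inl hvv'⟩
      · exact Or.inr ⟨Or.inr rfl, Or.inr rfl, Or.inl hvv'.symm⟩
  · intro u w huw
    by_cases hw : w ∈ s.outer
    · have hu : u ∈ s.outer := hI.outer_of_top_eq huw hw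
      simp only [hio u hu, hio w hw, if_false]
      exact hI.rk_top u w huw
    · obtain rfl := hsing u w huw hw
      rfl
  · rintro u (hu | rfl)
    · rw [Function.update_of_ne (hii u hu).1]
      simp only [hio _ (hI.inner_par u hu).1, hii u hu, if_false]
      exact hI.rk_par u hu
    · rw [Function.update_self]
      simp [hxv, hxv']
  · rintro u (hu | rfl) w huw
    · simp only [hio _ (hI.mate_inner u w huw hu), hii u hu, if_false]
      exact hI.rk_mate u hu w huw
    · obtain rfl := mate_unique hM huw hvv'
      simp [hne.symm]

/-- The ascent from an outer vertex to the root of its search tree. -/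
theorem exists_root_ascent (hI : SearchInv M s par rk) (hM : M.IsMatching) (n : ℕ) :
    ∀ x ∈ s.outer, rk x = n → ∃ r ns, (∀ u, ¬ M.Adj r u) ∧ Ascent M s par r x ns ∧
      ∀ u, (s.top u ∈ ns ∨ s.top u = s.top r) → s.forest.Reachable (s.top x) (s.top u) := by
  induction n using Nat.strong_induction_on with
  | _ n ih =>
  intro x hx hn
  obtain ⟨b, hbx, hb⟩ := hI.exists_isBase x
  by_cases hfree : ∀ u, ¬ M.Adj b u
  · refine ⟨b, [], hfree, .base x hbx.symm, fun u hu => ?_⟩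
    rw [show s.top u = s.top x from (by simpa using hu : s.top u = s.top b).trans hbx]
  · push Not at hfree
    obtain ⟨v, hbv⟩ := hfree
    have hbo : b ∈ s.outer := hI.outer_of_top_eq hbx hx
    -- A base that is not free has an inner mate, whose parent has smaller rank; the induction
    -- continues from that parent.
    have hv : v ∈ s.inner := (hI.mate_outer b v hbv hbo).resolve_right fun h => hb.1 v h.symm hbv
    obtain ⟨hp1, hp2, hp3, hp4, -⟩ := hI.inner_par v hv
    have r1 := hI.rk_par v hv
    have r2 := hI.rk_mate v hv b hbv.symm
    have r3 := hI.rk_top _ _ hbx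
    obtain ⟨r, ns, hr, hasc, hreach⟩ := ih (rk (par v)) (by omega) (par v) hp1 rfl
    have e1 : s.forest.Adj (s.top x) (s.top v) := by
      unfold SearchState.forest
      rw [SimpleGraph.fromRel_adj]
      exact ⟨hI.top_ne hx hv, Or.inr ⟨v, b, hI.matched_edge_mem hM hbv.symm hv, rfl, hbx⟩⟩
    have e2 : s.forest.Adj (s.top v) (s.top (par v)) := by
      unfold SearchState.forest
      rw [SimpleGraph.fromRel_adj]
      exact ⟨(hI.top_ne hp1 hv).symm, Or.inr ⟨par v, v, hp4, rfl, rfl⟩⟩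
    refine ⟨r, _, hr, .step x b v ns hbx hbv hv hasc, fun u hu => ?_⟩
    have e3 := e1.reachable.trans e2.reachable
    simp only [List.mem_cons, or_assoc] at hu
    rcases hu with hu | hu | hu
    · rw [hu]
    · rw [hu]
      exact e1.reachable
    · exact e3.trans (hreach u hu)

end SearchInv

/-! ### The dual invariant -/

/-- The difference of the two sides of the dual constraint of an edge. -/
noncomputable def edgeSlack (M : G.Subgraph) (s : SearchState V) (e : Sym2 V) : ℝ :=
  Sym2.lift ⟨fun u v => s.y u + s.y v, fun _ _ => add_comm _ _⟩ e +
    (∑ B ∈ s.blossoms, if Inside (B : Set V) e then s.z B else 0) - edgeWeight M.edgeSet e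

theorem edgeSlack_mk (M : G.Subgraph) (s : SearchState V) (u v : V) :
    edgeSlack M s s(u, v) = s.y u + s.y v +
      (∑ B ∈ s.blossoms, if u ∈ B ∧ v ∈ B then s.z B else 0) - edgeWeight M.edgeSet s(u, v) := by
  simp [edgeSlack]

theorem tight_iff {M : G.Subgraph} {s : SearchState V} {u v : V} :
    s.Tight M u v ↔ edgeSlack M s s(u, v) = 0 := by
  rw [edgeSlack_mk, SearchState.Tight, Finset.sum_filter, sub_eq_zero]

/-- The invariant of the dual variables. -/
structure DualInv (M : G.Subgraph) (s : SearchState V) (y₀ : ℝ) : Prop where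
  y_free : ∀ v, (∀ u, ¬ M.Adj v u) → s.y v = y₀
  slack_nonneg : ∀ u v, G.Adj u v → 0 ≤ edgeSlack M s s(u, v)
  slack_matched : ∀ u v, M.Adj u v → edgeSlack M s s(u, v) = 0
  slack_edges : ∀ u v, G.Adj u v → s(u, v) ∈ s.edges → edgeSlack M s s(u, v) = 0
  z_nonneg : ∀ B, 0 ≤ s.z B
  -- A blossom step leaves `z` untouched; this clause ensures that a blossom starts with dual 0.
  z_eq_zero : ∀ B, B ∉ s.blossoms → s.z B = 0

namespace DualInv

variable {M : G.Subgraph} {s : SearchState V} {par : V → V} {rk : V → ℕ} {y₀ : ℝ}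

theorem initial : DualInv M (SearchState.initial M) 1 where
  y_free _ _ := rfl
  slack_nonneg u v _ := by
    simp only [edgeSlack_mk, SearchState.initial, edgeWeight, Finset.sum_empty]
    split_ifs <;> norm_num
  slack_matched u v h := by
    have : s(u, v) ∈ M.edgeSet := h
    simp only [edgeSlack_mk, SearchState.initial, edgeWeight, Finset.sum_empty, this, if_true]
    norm_num
  slack_edges _ _ _ h := absurd h id
  z_nonneg _ := le_rfl
  z_eq_zero _ _ := rfl

theorem grow (hD : DualInv M s y₀) {x v v' : V} (ht : s.Tight M x v) (hvv' : M.Adj v v') :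
    DualInv M (s.grow x v v') y₀ :=
  { hD with
    slack_edges := by
      rintro u w huw (h | h)
      · exact hD.slack_edges u w huw h
      · change edgeSlack M s s(u, w) = 0
        rcases h with h | h
        · rw [h]
          exact tight_iff.1 ht
        · rw [h]
          exact hD.slack_matched v v' hvv' }

/-- A new blossom has dual 0, so it adds nothing to any constraint. -/
theorem edgeSlack_shrink (hD : DualInv M s y₀) (x v : V) (B : Finset V) (e : Sym2 V) :
    edgeSlack M (s.shrink x v B) e = edgeSlack M s e := by
  have : (∑ C ∈ insert B s.blossoms, if Inside (C : Set V) e then s.z C else 0) =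
      ∑ C ∈ s.blossoms, if Inside (C : Set V) e then s.z C else 0 := by
    by_cases hB : B ∈ s.blossoms
    · rw [Finset.insert_eq_of_mem hB]
    · rw [Finset.sum_insert hB, hD.z_eq_zero B hB]
      simp
  unfold edgeSlack
  exact congrArg (fun t => _ + t - _) this

theorem shrink (hD : DualInv M s y₀) {x v : V} (B : Finset V) (ht : s.Tight M x v) :
    DualInv M (s.shrink x v B) y₀ where
  y_free := hD.y_free
  slack_nonneg u w h := by
    rw [hD.edgeSlack_shrink]
    exact hD.slack_nonneg u w h
  slack_matched u w h := by
    rw [hD.edgeSlack_shrink]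
    exact hD.slack_matched u w h
  slack_edges u w h := by
    rw [hD.edgeSlack_shrink]
    rintro (he | he)
    · exact hD.slack_edges u w h he
    · rw [show s(u, w) = s(x, v) from he]
      exact tight_iff.1 ht
  z_nonneg := hD.z_nonneg
  z_eq_zero C hC := hD.z_eq_zero C fun h => hC (Finset.mem_insert_of_mem h)

theorem sum_eq_zero (hI : SearchInv M s par rk) (z : Finset V → ℝ) {u v : V}
    (h : s.top u ≠ s.top v) :
    (∑ B ∈ s.blossoms, if u ∈ B ∧ v ∈ B then z B else 0) = 0 := by
  refine Finset.sum_eq_zero fun B hB => if_neg fun hB' => h ?_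
  exact hI.top_eq_of_mem hB hB'.1 hB'.2

/-- The common node of two distinct vertices is a blossom, and it is the only maximal one that
contains both. Its increase of `2 * δ` offsets the two decreases of `y`. -/
theorem sum_adjust (hI : SearchInv M s par rk) (δ : ℝ) {u v : V} (huv : u ≠ v)
    (h : s.top u = s.top v) :
    (∑ B ∈ s.blossoms, if u ∈ B ∧ v ∈ B then (s.adjust δ).z B else 0) =
      (∑ B ∈ s.blossoms, if u ∈ B ∧ v ∈ B then s.z B else 0) + 2 * δ := by
  rcases node_eq_member_or_singleton hI.laminar (Finset.finite_toSet _) v with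
    ⟨B, hB, hvB, hnode⟩ | hnode
  · have huB : u ∈ B := (hnode u).1 h
    have hout : ∀ C ∈ s.blossoms, (C : Set V) ⊆ s.outer := fun C hC w hw =>
      hI.blossom_outer C hC w hw
    have hmax : ∀ C ∈ s.blossoms, u ∈ C ∧ v ∈ C → (s.IsMaxOuterBlossom C ↔ C = B) := by
      rintro C hC ⟨-, hvC⟩
      have hCB : C ⊆ B := fun w hw => (hnode w).1 (hI.top_eq_of_mem hC hw hvC)
      constructor
      · intro hm
        exact subset_antisymm hCB (hm.2 ⟨hB, hout B hB⟩ hCB)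
      · rintro rfl
        refine ⟨⟨hB, hout _ hB⟩, fun D hD hCD w hw => ?_⟩
        exact (hnode w).1 (hI.top_eq_of_mem hD.1 hw (hCD hvB))
    have hstep : ∀ C ∈ s.blossoms, (if u ∈ C ∧ v ∈ C then (s.adjust δ).z C else 0) =
        (if u ∈ C ∧ v ∈ C then s.z C else 0) + (if C = B then 2 * δ else 0) := by
      intro C hC
      by_cases hC' : u ∈ C ∧ v ∈ C
      · simp only [hC', SearchState.adjust, hmax C hC hC', and_self, if_true]
        split_ifs <;> ring
      · have : C ≠ B := fun h => hC' (h ▸ ⟨huB, hvB⟩)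
        simp [hC', this]
    rw [Finset.sum_congr rfl hstep, Finset.sum_add_distrib, Finset.sum_ite_eq',
      if_pos (Finset.mem_coe.1 hB)]
  · exact absurd ((hnode u).1 h) huv

/-- Slacks do not change inside a node or between an inner and an outer vertex. The other edges at
outer vertices are exactly those that bound `δ`, and edges without an outer end cannot lose slack.
All free vertices are outer, so their common value drops to `y₀ - δ`. -/
theorem adjust (hD : DualInv M s y₀) (hI : SearchInv M s par rk) {δ : ℝ}
    (hδ : IsLeast (s.adjustSet M) δ) : DualInv M (s.adjust δ) (y₀ - δ) := by
  have hy : ∀ u, (s.adjust δ).y u =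
      if u ∈ s.inner then s.y u + δ else if u ∈ s.outer then s.y u - δ else s.y u := fun u => rfl
  have hyo : ∀ u ∈ s.outer, (s.adjust δ).y u = s.y u - δ := fun u hu => by
    rw [hy, if_neg (hI.disjoint u hu), if_pos hu]
  have hyi : ∀ u ∈ s.inner, (s.adjust δ).y u = s.y u + δ := fun u hu => by rw [hy, if_pos hu]
  have hyn : ∀ u, u ∉ s.outer → u ∉ s.inner → (s.adjust δ).y u = s.y u := fun u h h' => by
    rw [hy, if_neg h', if_neg h]
  have hout : ∀ u v, u ≠ v → s.top u = s.top v → u ∈ s.outer ∧ v ∈ s.outer := by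
    intro u v huv h
    rcases hI.top_eq_iff.1 h with h | ⟨B, hB, h1, h2⟩
    · exact absurd h huv
    · exact ⟨hI.blossom_outer B hB u h1, hI.blossom_outer B hB v h2⟩
  have hsame : ∀ u v, u ≠ v → s.top u = s.top v →
      edgeSlack M (s.adjust δ) s(u, v) = edgeSlack M s s(u, v) := by
    intro u v huv h
    obtain ⟨h1, h2⟩ := hout u v huv h
    have := sum_adjust hI δ huv h
    rw [edgeSlack_mk, edgeSlack_mk, hyo u h1, hyo v h2]
    change _ + (∑ B ∈ s.blossoms, _) - _ = _
    rw [this]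
    ring
  have hdiff : ∀ u v, s.top u ≠ s.top v →
      edgeSlack M (s.adjust δ) s(u, v) =
        (s.adjust δ).y u + (s.adjust δ).y v - edgeWeight M.edgeSet s(u, v) := by
    intro u v h
    have := sum_eq_zero hI (s.adjust δ).z h
    rw [edgeSlack_mk]
    change _ + (∑ B ∈ s.blossoms, _) - _ = _
    rw [this, add_zero]
  have hdiff' : ∀ u v, s.top u ≠ s.top v →
      edgeSlack M s s(u, v) = s.y u + s.y v - edgeWeight M.edgeSet s(u, v) := by
    intro u v h
    rw [edgeSlack_mk, sum_eq_zero hI s.z h, add_zero]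
  have hne_of : ∀ u v, u ∈ s.outer → v ∉ s.outer → s.top u ≠ s.top v := fun u v hu hv h =>
    hv (hI.outer_of_top_eq h.symm hu)
  have hδ0 : 0 ≤ δ := by
    rcases hδ.1 with ⟨u, v, hadj, hu, hv, rfl⟩ | ⟨u, v, hadj, hu, hv, hne, rfl⟩
    · rw [← hdiff' u v (hne_of u v hu fun h => hv (Or.inl h))]
      exact hD.slack_nonneg u v hadj
    · rw [← hdiff' u v hne]
      have := hD.slack_nonneg u v hadj
      linarith
  have houtun : ∀ u v, G.Adj u v → u ∈ s.outer → v ∉ s.outer → v ∉ s.inner →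
      δ ≤ s.y u + s.y v - edgeWeight M.edgeSet s(u, v) := fun u v h hu hv hv' =>
    hδ.2 (Or.inl ⟨u, v, h, hu, fun h => h.elim hv hv', rfl⟩)
  have houtout : ∀ u v, G.Adj u v → u ∈ s.outer → v ∈ s.outer → s.top u ≠ s.top v →
      δ ≤ (s.y u + s.y v - edgeWeight M.edgeSet s(u, v)) / 2 := fun u v h hu hv hne =>
    hδ.2 (Or.inr ⟨u, v, h, hu, hv, hne, rfl⟩)
  have hio : ∀ u v, u ∈ s.inner → v ∈ s.outer →
      edgeSlack M (s.adjust δ) s(u, v) = edgeSlack M s s(u, v) := by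
    intro u v hu hv
    have hne := (hI.top_ne hv hu).symm
    rw [hdiff u v hne, hdiff' u v hne, hyi u hu, hyo v hv]
    ring
  have hoi : ∀ u v, u ∈ s.outer → v ∈ s.inner →
      edgeSlack M (s.adjust δ) s(u, v) = edgeSlack M s s(u, v) := by
    intro u v hu hv
    rw [Sym2.eq_swap]
    exact hio v u hv hu
  refine ⟨fun v hv => ?_, fun u v hadj => ?_, fun u v h => ?_, fun u v hadj he => ?_, ?_, ?_⟩
  · rw [hyo v (hI.free_outer v hv), hD.y_free v hv]
  · have h0 := hD.slack_nonneg u v hadj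
    by_cases hne : s.top u = s.top v
    · rwa [hsame u v hadj.ne hne]
    · rw [hdiff u v hne]
      rw [hdiff' u v hne] at h0
      by_cases hu : u ∈ s.outer
      · by_cases hv : v ∈ s.outer
        · have := houtout u v hadj hu hv hne
          rw [hyo u hu, hyo v hv]
          linarith
        · by_cases hv' : v ∈ s.inner
          · rw [hyo u hu, hyi v hv']
            linarith
          · have := houtun u v hadj hu hv hv'
            rw [hyo u hu, hyn v hv hv']
            linarith
      · have hu' : s.y u ≤ (s.adjust δ).y u := by
          by_cases hu' : u ∈ s.inner
          · rw [hyi u hu']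
            linarith
          · rw [hyn u hu hu']
        by_cases hv : v ∈ s.outer
        · by_cases hu' : u ∈ s.inner
          · rw [hyo v hv, hyi u hu']
            linarith
          · have := houtun v u hadj.symm hv hu hu'
            rw [hyo v hv, hyn u hu hu']
            rw [Sym2.eq_swap] at this
            linarith
        · have hv' : s.y v ≤ (s.adjust δ).y v := by
            by_cases hv' : v ∈ s.inner
            · rw [hyi v hv']
              linarith
            · rw [hyn v hv hv']
          linarith
  · have h0 := hD.slack_matched u v h
    by_cases hu : u ∈ s.outer
    · rcases hI.mate_outer u v h hu with hv | htop
      · rw [hoi u v hu hv, h0]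
      · rw [hsame u v h.ne htop, h0]
    · by_cases hu' : u ∈ s.inner
      · rw [hio u v hu' (hI.mate_inner u v h hu'), h0]
      -- If one end of a matched edge is outside the search structure, so is the other; then neither
      -- dual changes.
      · have hv : v ∉ s.outer := fun hv => (hI.mate_outer v u h.symm hv).elim hu' fun h' =>
          hu (hI.outer_of_top_eq h'.symm hv)
        have hv' : v ∉ s.inner := fun hv' => hu (hI.mate_inner v u h.symm hv')
        have hne : s.top u ≠ s.top v := fun h' => hu (hout u v h.ne h').1
        rw [hdiff u v hne, hyn u hu hu', hyn v hv hv', ← hdiff' u v hne, h0]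
  · have h0 := hD.slack_edges u v hadj he
    rcases hI.edge_cases u v he with h | ⟨h1, h2, -⟩ | ⟨h1, h2, -⟩
    · rw [hsame u v hadj.ne h, h0]
    · rw [hio u v h1 h2, h0]
    · rw [hoi u v h2 h1, h0]
  · intro B
    have := hD.z_nonneg B
    simp only [SearchState.adjust]
    split_ifs <;> linarith
  · intro B hB
    simp only [SearchState.adjust]
    rw [if_neg fun h : s.IsMaxOuterBlossom B => hB h.1.1]
    exact hD.z_eq_zero B hB

end DualInv

theorem exists_invariants {M : G.Subgraph} (hM : M.IsMatching) {s : SearchState V}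
    (h : Relation.ReflTransGen (SearchStep M) (SearchState.initial M) s) :
    ∃ par rk y₀, SearchInv M s par rk ∧ DualInv M s y₀ := by
  induction h with
  | refl => exact ⟨_, _, _, .initial, .initial⟩
  | tail _ hstep ih =>
    obtain ⟨par, rk, y₀, hI, hD⟩ := ih
    cases hstep with
    | grow x v v' hel hv hvv' =>
      obtain ⟨hadj, ht, hx, -⟩ := hel
      obtain ⟨par', rk', hI'⟩ := hI.grow hM hadj hx hv hvv'
      exact ⟨par', rk', y₀, hI', hD.grow ht hvv'⟩
    | blossom x v p B hel hv hp hB =>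
      obtain ⟨hadj, ht, hx, hne⟩ := hel
      obtain ⟨rk', hI'⟩ := hI.shrink hM p hadj hx hne hv hp hB
      exact ⟨par, rk', y₀, hI', hD.shrink B ht⟩
    | adjust δ _ hδ => exact ⟨par, rk, y₀ - δ, hI.adjust δ, hD.adjust hI hδ⟩

/-! ### Augmenting paths of a simple graph -/

theorem isLink_ofSimpleGraph {e : Sym2 V} {a b : V} :
    (Graph.ofSimpleGraph G).IsLink e a b ↔ G.Adj a b ∧ e = s(a, b) := by
  simp only [Graph.ofSimpleGraph]
  constructor
  · rintro ⟨rfl, h⟩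
    exact ⟨by simpa using h, rfl⟩
  · rintro ⟨h, rfl⟩
    exact ⟨rfl, by simpa using h⟩

/-- The list of steps, starting at `a` with an unmatched edge, is the remainder of an augmenting
path. -/
inductive AugTail (M : G.Subgraph) : V → List (Sym2 V × V) → Prop
  | single (a v : V) : G.Adj a v → ¬ M.Adj a v → (∀ u, ¬ M.Adj v u) → AugTail M a [(s(a, v), v)]
  | step (a v₁ v₂ : V) (l : List (Sym2 V × V)) : G.Adj a v₁ → ¬ M.Adj a v₁ → M.Adj v₁ v₂ →
      (a :: v₁ :: v₂ :: l.map Prod.snd).Nodup → AugTail M v₂ l →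
      AugTail M a ((s(a, v₁), v₁) :: (s(v₁, v₂), v₂) :: l)

theorem augTail_of_linked {M : G.Subgraph} (n : ℕ) : ∀ (a : V) (l : List (Sym2 V × V)),
    l.length = n → Linked (Graph.ofSimpleGraph G) a l → (a :: l.map Prod.snd).Nodup →
    Alt M.edgeSet false (l.map Prod.fst) → Odd l.length →
    (∀ u, ¬ M.Adj ((a :: l.map Prod.snd).getLast (by simp)) u) → AugTail M a l := by
  induction n using Nat.strong_induction_on with
  | _ n ih =>
  intro a l hn hL hN hA hO hF
  match l, hn, hL, hN, hA, hO, hF with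
  | [(e, v)], _, hL, _, hA, _, hF =>
    obtain ⟨h1, rfl⟩ := isLink_ofSimpleGraph.1 hL.1
    exact .single a v h1 (by simpa using hA) (by simpa using hF)
  | (e₁, v₁) :: (e₂, v₂) :: l, hn, hL, hN, hA, hO, hF =>
    obtain ⟨h1, h2, h3⟩ := hL
    obtain ⟨hadj, rfl⟩ := isLink_ofSimpleGraph.1 h1
    obtain ⟨-, rfl⟩ := isLink_ofSimpleGraph.1 h2
    simp only [List.map_cons, alt_cons, Bool.not_false, Bool.not_true] at hA
    refine .step a v₁ v₂ l hadj (by simpa using hA.1) (by simpa using hA.2.1) hN ?_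
    refine ih l.length (by simp at hn; omega) v₂ l rfl h3 ?_ hA.2.2 ?_ ?_
    · exact hN.sublist (((List.Sublist.refl _).cons _).cons _)
    · simpa [Nat.odd_add] using hO
    · simpa using hF

theorem IsAugmentingPath.augTail {M : G.Subgraph} {P : EdgePath V (Sym2 V)}
    (h : IsAugmentingPath (Graph.ofSimpleGraph G) M.edgeSet P) : AugTail M P.start P.steps := by
  obtain ⟨hL, hN, hA, hO, -, hf⟩ := isAugmentingPath_iff.1 h
  exact augTail_of_linked _ _ _ rfl hL hN hA hO (isFree_ofSimpleGraph_iff.1 hf)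

/-- The edges and vertices that a walk visits after its first vertex. -/
def walkSteps : ∀ {a b : V}, G.Walk a b → List (Sym2 V × V)
  | _, _, .nil => []
  | a, _, .cons (v := v) _ p => (s(a, v), v) :: walkSteps p

theorem walkSteps_fst {a b : V} (w : G.Walk a b) : (walkSteps w).map Prod.fst = w.edges := by
  induction w with
  | nil => rfl
  | cons h p ih => simp [walkSteps, ih]

theorem walkSteps_snd {a b : V} (w : G.Walk a b) : a :: (walkSteps w).map Prod.snd = w.support := by
  induction w with
  | nil => rfl
  | cons h p ih => simp [walkSteps, ih]

theorem linked_walkSteps {a b : V} (w : G.Walk a b) :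
    Linked (Graph.ofSimpleGraph G) a (walkSteps w) := by
  induction w with
  | nil => trivial
  | cons h p ih => exact ⟨isLink_ofSimpleGraph.2 ⟨h, rfl⟩, ih⟩

theorem walkSteps_append {a b c : V} (w : G.Walk a b) (w' : G.Walk b c) :
    walkSteps (w.append w') = walkSteps w ++ walkSteps w' := by
  induction w with
  | nil => rfl
  | cons h p ih => simp [walkSteps, ih]

/-! ### Optimal augmenting walks -/

/-- An alternating path with vertices in `S` and edges in `E` that starts and ends with an unmatched
edge and is balanced with respect to every member of `F`. -/
structure OptWalk (M : G.Subgraph) (E : Set (Sym2 V)) (F : Finset (Finset V)) (S : Set V)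
    {a b : V} (w : G.Walk a b) : Prop where
  isPath : w.IsPath
  support_subset : ∀ u ∈ w.support, u ∈ S
  alt : Alt M.edgeSet false w.edges
  odd : Odd w.length
  edges_mem : ∀ e ∈ w.edges, e ∈ E
  balanced : ∀ B ∈ F, defect M.edgeSet (B : Set V) w.edges = 0

/-- Both good walks end at the link with a matched edge or are trivial. Reversing the second puts
the unmatched edge at its start at the far end, so the result starts and ends unmatched. -/
theorem GoodWalk.optWalk {M : G.Subgraph} {E : Set (Sym2 V)} {F : Finset (Finset V)}
    {S₁ S₂ : Set V} {a b c d : V} {w₁ : G.Walk a b} {w₂ : G.Walk d c}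
    (h₁ : GoodWalk M E F S₁ false w₁) (h₂ : GoodWalk M E F S₂ false w₂) (hbc : G.Adj b c)
    (hM : ¬ M.Adj b c) (hE : s(b, c) ∈ E) (hF : ∀ B ∈ F, b ∈ B → c ∉ B)
    (hS : ∀ u ∈ S₁, u ∉ S₂) :
    OptWalk M E F (S₁ ∪ S₂) (w₁.append (SimpleGraph.Walk.cons hbc w₂.reverse)) where
  isPath := by
    rw [SimpleGraph.Walk.isPath_def, SimpleGraph.Walk.support_append,
      SimpleGraph.Walk.support_cons, List.tail_cons, List.nodup_append]
    refine ⟨h₁.isPath.support_nodup, h₂.isPath.reverse.support_nodup, ?_⟩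
    rintro u hu v hv rfl
    exact hS u (h₁.support_subset u hu) (h₂.support_subset u (by simpa using hv))
  support_subset u hu := by
    rw [SimpleGraph.Walk.support_append, SimpleGraph.Walk.support_cons, List.tail_cons,
      List.mem_append] at hu
    exact hu.imp (h₁.support_subset u) fun hu => h₂.support_subset u (by simpa using hu)
  alt := by
    have h1 := h₁.even_iff.2 rfl
    have h2 := h₂.even_iff.2 rfl
    rw [← SimpleGraph.Walk.length_edges] at h1 h2
    rw [SimpleGraph.Walk.edges_append, SimpleGraph.Walk.edges_cons, alt_append_of_even h1]
    refine ⟨h₁.alt, ?_, ?_⟩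
    · simpa using hM
    · have := h₂.alt.reverse
      rw [if_pos h2] at this
      rwa [SimpleGraph.Walk.edges_reverse]
  odd := by
    have h1 := h₁.even_iff.2 rfl
    have h2 := h₂.even_iff.2 rfl
    rw [SimpleGraph.Walk.length_append, SimpleGraph.Walk.length_cons,
      SimpleGraph.Walk.length_reverse]
    exact h1.add_odd h2.add_one
  edges_mem e he := by
    rw [SimpleGraph.Walk.edges_append, SimpleGraph.Walk.edges_cons, List.mem_append,
      List.mem_cons] at he
    rcases he with he | rfl | he
    · exact h₁.edges_mem e he
    · exact hE
    · exact h₂.edges_mem e (by simpa using he)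
  balanced B hB := by
    rw [SimpleGraph.Walk.edges_append, SimpleGraph.Walk.edges_cons, defect_append, defect_cons,
      SimpleGraph.Walk.edges_reverse, defect_reverse, h₁.balanced B hB, h₂.balanced B hB, if_neg]
    · rfl
    · rw [inside_mk]
      exact fun h => hF B hB h.1 h.2

theorem OptWalk.append {M : G.Subgraph} {E : Set (Sym2 V)} {F : Finset (Finset V)}
    {S₁ S₂ : Set V} {a b c d : V} {w₁ : G.Walk a b} {w₂ : G.Walk c d}
    (h₁ : OptWalk M E F S₁ w₁) (h₂ : OptWalk M E F S₂ w₂) (hbc : M.Adj b c)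
    (hE : s(b, c) ∈ E) (hF : ∀ B ∈ F, b ∈ B → c ∉ B) (hS : ∀ u ∈ S₁, u ∉ S₂) :
    OptWalk M E F (S₁ ∪ S₂) (w₁.append (SimpleGraph.Walk.cons hbc.adj_sub w₂)) where
  isPath := by
    rw [SimpleGraph.Walk.isPath_def, SimpleGraph.Walk.support_append,
      SimpleGraph.Walk.support_cons, List.tail_cons, List.nodup_append]
    refine ⟨h₁.isPath.support_nodup, h₂.isPath.support_nodup, ?_⟩
    rintro u hu v hv rfl
    exact hS u (h₁.support_subset u hu) (h₂.support_subset u hv)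
  support_subset u hu := by
    rw [SimpleGraph.Walk.support_append, SimpleGraph.Walk.support_cons, List.tail_cons,
      List.mem_append] at hu
    exact hu.imp (h₁.support_subset u) (h₂.support_subset u)
  alt := by
    have h1 := Nat.not_even_iff_odd.2 h₁.odd
    rw [← SimpleGraph.Walk.length_edges] at h1
    rw [SimpleGraph.Walk.edges_append, SimpleGraph.Walk.edges_cons, alt_append_of_odd h1]
    exact ⟨h₁.alt, by simpa using hbc, h₂.alt⟩
  odd := by
    rw [SimpleGraph.Walk.length_append, SimpleGraph.Walk.length_cons]
    exact h₁.odd.add_even h₂.odd.add_one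
  edges_mem e he := by
    rw [SimpleGraph.Walk.edges_append, SimpleGraph.Walk.edges_cons, List.mem_append,
      List.mem_cons] at he
    rcases he with he | rfl | he
    · exact h₁.edges_mem e he
    · exact hE
    · exact h₂.edges_mem e he
  balanced B hB := by
    rw [SimpleGraph.Walk.edges_append, SimpleGraph.Walk.edges_cons, defect_append, defect_cons,
      h₁.balanced B hB, h₂.balanced B hB, if_neg]
    · rfl
    · rw [inside_mk]
      exact fun h => hF B hB h.1 h.2

theorem OptWalk.isAugmentingPath {M : G.Subgraph} {E : Set (Sym2 V)} {F : Finset (Finset V)}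
    {S : Set V} {a b : V} {w : G.Walk a b} (h : OptWalk M E F S w) (ha : ∀ u, ¬ M.Adj a u)
    (hb : ∀ u, ¬ M.Adj b u) :
    IsAugmentingPath (Graph.ofSimpleGraph G) M.edgeSet ⟨a, walkSteps w⟩ := by
  rw [isAugmentingPath_iff]
  refine ⟨linked_walkSteps w, ?_, ?_, ?_, isFree_ofSimpleGraph_iff.2 ha, ?_⟩
  · rw [walkSteps_snd]
    exact h.isPath.support_nodup
  · rw [walkSteps_fst]
    exact h.alt
  · have := congrArg List.length (walkSteps_fst w)
    rw [List.length_map, SimpleGraph.Walk.length_edges] at this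
    change Odd (walkSteps w).length
    rw [this]
    exact h.odd
  · simp only [walkSteps_snd, SimpleGraph.Walk.getLast_support]
    exact isFree_ofSimpleGraph_iff.2 hb

/-! ### Weights and duals -/

/-- Interchanging the sums over edges and blossoms collects the coefficient of each `z(B)` into a
defect. -/
theorem sum_edgeSign_mul (M : G.Subgraph) (s : SearchState V) (l : List (Sym2 V)) :
    (l.map (fun e => edgeSign M.edgeSet e *
      ∑ B ∈ s.blossoms, if Inside (B : Set V) e then s.z B else 0)).sum =
      ∑ B ∈ s.blossoms, s.z B * defect M.edgeSet (B : Set V) l := by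
  induction l with
  | nil => simp
  | cons e l ih =>
    rw [List.map_cons, List.sum_cons, ih, Finset.mul_sum, ← Finset.sum_add_distrib]
    refine Finset.sum_congr rfl fun B _ => ?_
    rw [defect_cons, edgeSign]
    split_ifs <;> push_cast <;> ring

/-- Replacing each weight by its dual expression minus the slack gives a telescoping sum:
consecutive edges have opposite signs, so only the two end values of `y` survive. -/
theorem sum_weight_eq {M : G.Subgraph} (s : SearchState V) {a : V} {l : List (Sym2 V × V)}
    {b : Bool} (hL : Linked (Graph.ofSimpleGraph G) a l)
    (hA : Alt M.edgeSet b (l.map Prod.fst)) :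
    ((l.map Prod.fst).map (fun e => edgeSign M.edgeSet e * edgeWeight M.edgeSet e)).sum =
      (if b then -1 else 1) * s.y a +
      (if Even l.length then (if b then 1 else -1) else (if b then -1 else 1)) *
        s.y ((a :: l.map Prod.snd).getLast (by simp)) +
      ∑ B ∈ s.blossoms, s.z B * defect M.edgeSet (B : Set V) (l.map Prod.fst) -
      ((l.map Prod.fst).map (fun e => edgeSign M.edgeSet e * edgeSlack M s e)).sum := by
  rw [← sum_edgeSign_mul]
  induction l generalizing a b with
  | nil => cases b <;> simp
  | cons p l ih =>
    obtain ⟨e, v⟩ := p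
    obtain ⟨h1, h2⟩ := hL
    obtain ⟨-, rfl⟩ := isLink_ofSimpleGraph.1 h1
    rw [List.map_cons, alt_cons] at hA
    have := ih h2 hA.2
    have hw : edgeWeight M.edgeSet s(a, v) = s.y a + s.y v +
        (∑ B ∈ s.blossoms, if Inside (B : Set V) s(a, v) then s.z B else 0) -
          edgeSlack M s s(a, v) := by
      simp only [edgeSlack, Sym2.lift_mk]
      ring
    have hs : edgeSign M.edgeSet s(a, v) = if b then -1 else 1 := by
      rw [edgeSign]
      have := hA.1
      cases b <;> simp_all
    have hlast : (a :: v :: l.map Prod.snd).getLast (by simp) =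
        (v :: l.map Prod.snd).getLast (by simp) := List.getLast_cons (by simp)
    simp only [List.map_cons, List.sum_cons, this, List.length_cons, Nat.even_add_one, hlast]
    rw [hw, hs]
    generalize s.y ((v :: l.map Prod.snd).getLast _) = t
    by_cases ho : Even l.length <;> cases b <;> simp [ho, -Nat.not_even_iff_odd] <;> ring

theorem IsAugmentingPath.pathWeight_eq {M : G.Subgraph} {s : SearchState V} {y₀ : ℝ}
    (hD : DualInv M s y₀) {P : EdgePath V (Sym2 V)}
    (h : IsAugmentingPath (Graph.ofSimpleGraph G) M.edgeSet P) :
    pathWeight M.edgeSet P = 2 * y₀ +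
      ∑ B ∈ s.blossoms, s.z B * defect M.edgeSet (B : Set V) P.edges -
      (P.edges.map (fun e => edgeSign M.edgeSet e * edgeSlack M s e)).sum := by
  obtain ⟨hL, -, hA, hO, hs, hf⟩ := isAugmentingPath_iff.1 h
  rw [CardMatching.pathWeight_eq]
  have := sum_weight_eq s hL hA
  rw [if_neg (Nat.not_even_iff_odd.2 hO), hD.y_free _ (isFree_ofSimpleGraph_iff.1 hs),
    hD.y_free _ (isFree_ofSimpleGraph_iff.1 hf)] at this
  simp only [EdgePath.edges, this]
  simp
  ring

/-- The sign is negative only on matched edges, where the slack vanishes. -/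
theorem edgeSign_mul_slack_nonneg {M : G.Subgraph} {s : SearchState V} {y₀ : ℝ}
    (hD : DualInv M s y₀) {a : V} {l : List (Sym2 V × V)}
    (h : Linked (Graph.ofSimpleGraph G) a l) :
    ∀ e ∈ l.map Prod.fst, 0 ≤ edgeSign M.edgeSet e * edgeSlack M s e ∧
      (edgeSign M.edgeSet e * edgeSlack M s e = 0 → edgeSlack M s e = 0) := by
  induction l generalizing a with
  | nil => simp
  | cons p l ih =>
    obtain ⟨e, v⟩ := p
    obtain ⟨h1, h2⟩ := h
    intro f hf
    rw [List.map_cons, List.mem_cons] at hf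
    rcases hf with rfl | hf
    · obtain ⟨hadj, rfl⟩ := isLink_ofSimpleGraph.1 h1
      have h0 := hD.slack_nonneg a v hadj
      unfold edgeSign
      split_ifs with hM
      · have := hD.slack_matched a v hM
        simp [this]
      · simpa using h0
    · exact ih h2 f hf

/-! ### Balance of augmenting paths -/

/-- `b` is in `C` and is the only vertex of `C` that is not matched inside `C`. -/
structure Based (M : G.Subgraph) (C : Set V) (b : V) : Prop where
  mem : b ∈ C
  not_adj : ∀ v ∈ C, ¬ M.Adj b v
  exists_mate : ∀ v ∈ C, v ≠ b → ∃ u ∈ C, M.Adj v u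

/-- The contribution to the balance of `C` along the remainder `l` of an augmenting path from `a`
if that remainder is optimal. -/
noncomputable def expected (C : Set V) (b a : V) (vs : List V) : ℤ :=
  if a ∈ C ∧ b ∈ vs then 1 else 0

theorem Based.eq_of_free {M : G.Subgraph} {C : Set V} {b : V} (h : Based M C b) {v : V}
    (hv : v ∈ C) (hfree : ∀ u, ¬ M.Adj v u) : v = b := by
  by_contra hne
  obtain ⟨u, -, hu⟩ := h.exists_mate v hv hne
  exact hfree u hu

theorem Based.mem_of_adj {M : G.Subgraph} (hM : M.IsMatching) {C : Set V} {b : V}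
    (h : Based M C b) {u v : V} (huv : M.Adj u v) (hu : u ∈ C) (hne : u ≠ b) : v ∈ C := by
  obtain ⟨w, hw, huw⟩ := h.exists_mate u hu hne
  rwa [mate_unique hM huv huw]

/-! ### Two consecutive edges measured against a set with a base -/

section Step

variable {M : G.Subgraph} {C : Set V} {b a v₁ v₂ : V} {l : List (Sym2 V × V)}

/-- The edges are an unmatched one followed by a matched one. A matched edge can enter or leave `C`
only at `b`, and simplicity allows `b` once; the inequality is then a finite check of memberships.
-/
theorem expected_step_le (hM : M.IsMatching) (hC : Based M C b) (h12 : M.Adj v₁ v₂) {vs : List V}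
    (hN : (a :: v₁ :: v₂ :: vs).Nodup) :
    (if a ∈ C ∧ v₁ ∈ C then 1 else 0) - (if v₁ ∈ C ∧ v₂ ∈ C then 1 else 0) +
      expected C b v₂ vs ≤ expected C b a (v₁ :: v₂ :: vs) := by
  have k1 := hC.mem_of_adj hM h12
  have k2 := hC.mem_of_adj hM h12.symm
  have k3 : v₁ = b → v₂ ∉ C := fun h h' => hC.not_adj v₂ h' (h ▸ h12)
  have k4 : v₂ = b → v₁ ∉ C := fun h h' => hC.not_adj v₁ h' (h ▸ h12.symm)
  have k5 := hC.mem
  unfold expected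
  grind

/-- The three conclusions list what zero waste forbids: after leaving `C` by an unmatched edge the
base is no longer met; entering by an unmatched edge and staying for the matched one requires the
base ahead; without the base ahead `C` is not entered. -/
theorem expected_step_eq (hM : M.IsMatching) (hC : Based M C b) (h12 : M.Adj v₁ v₂) {vs : List V}
    (hN : (a :: v₁ :: v₂ :: vs).Nodup)
    (h : (if a ∈ C ∧ v₁ ∈ C then 1 else 0) - (if v₁ ∈ C ∧ v₂ ∈ C then 1 else 0) +
      expected C b v₂ vs = expected C b a (v₁ :: v₂ :: vs)) :
    (a ∈ C → v₁ ∉ C → v₂ ∉ C ∧ b ∉ v₁ :: v₂ :: vs) ∧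
    (a ∉ C → v₁ ∈ C → v₂ ∈ C → b ∈ vs) ∧
    (a ∉ C → b ∉ v₁ :: v₂ :: vs → v₁ ∉ C ∧ v₂ ∉ C) := by
  have k1 := hC.mem_of_adj hM h12
  have k2 := hC.mem_of_adj hM h12.symm
  have k3 : v₁ = b → v₂ ∉ C := fun h h' => hC.not_adj v₂ h' (h ▸ h12)
  have k4 : v₂ = b → v₁ ∉ C := fun h h' => hC.not_adj v₁ h' (h ▸ h12.symm)
  have k5 := hC.mem
  unfold expected at h
  grind

theorem defect_step (h1 : ¬ M.Adj a v₁) (h12 : M.Adj v₁ v₂) :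
    defect M.edgeSet C (((s(a, v₁), v₁) :: (s(v₁, v₂), v₂) :: l).map Prod.fst) =
      (if a ∈ C ∧ v₁ ∈ C then 1 else 0) - (if v₁ ∈ C ∧ v₂ ∈ C then 1 else 0) +
        defect M.edgeSet C (l.map Prod.fst) := by
  simp only [List.map_cons, defect_cons, inside_mk, SimpleGraph.Subgraph.mem_edgeSet, h1, h12,
    if_true, if_false]
  split_ifs <;> ring

end Step

/-- A stretch of the path inside `C` that avoids `b` begins and ends with matched edges and loses 1.
A gain is possible only on a stretch that starts at `a` inside `C` with an unmatched edge and ends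
at `b` after one; `expected` allows for it. -/
theorem AugTail.defect_le {M : G.Subgraph} (hM : M.IsMatching) {C : Set V} {b : V}
    (hC : Based M C b) {a : V} {l : List (Sym2 V × V)} (h : AugTail M a l) :
    defect M.edgeSet C (l.map Prod.fst) ≤ expected C b a (l.map Prod.snd) := by
  induction h with
  | single a v hadj hnM hfree =>
    have := hC.eq_of_free (v := v)
    simp only [List.map_cons, List.map_nil, defect_cons, inside_mk,
      SimpleGraph.Subgraph.mem_edgeSet, hnM, if_false, defect_nil, expected, List.mem_singleton]
    have k := hC.mem
    split_ifs <;> grind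
  | step a v₁ v₂ l hadj hnM h12 hN htail ih =>
    rw [defect_step hnM h12]
    have := expected_step_le hM hC h12 hN
    simp only [List.map_cons]
    omega

/-- The step and the remainder each satisfy an inequality, so equality for their sum forces equality
in both. -/
theorem AugTail.balanced_step {M : G.Subgraph} (hM : M.IsMatching) {C : Set V} {b : V}
    (hC : Based M C b) {a v₁ v₂ : V} {l : List (Sym2 V × V)} (hnM : ¬ M.Adj a v₁)
    (h12 : M.Adj v₁ v₂) (hN : (a :: v₁ :: v₂ :: l.map Prod.snd).Nodup) (htail : AugTail M v₂ l)
    (h : defect M.edgeSet C (((s(a, v₁), v₁) :: (s(v₁, v₂), v₂) :: l).map Prod.fst) =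
      expected C b a (v₁ :: v₂ :: l.map Prod.snd)) :
    defect M.edgeSet C (l.map Prod.fst) = expected C b v₂ (l.map Prod.snd) ∧
    (a ∈ C → v₁ ∉ C → v₂ ∉ C ∧ b ∉ v₁ :: v₂ :: l.map Prod.snd) ∧
    (a ∉ C → v₁ ∈ C → v₂ ∈ C → b ∈ l.map Prod.snd) ∧
    (a ∉ C → b ∉ v₁ :: v₂ :: l.map Prod.snd → v₁ ∉ C ∧ v₂ ∉ C) := by
  rw [defect_step hnM h12] at h
  have h1 := expected_step_le hM hC h12 hN
  have h2 := htail.defect_le hM hC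
  have h3 : defect M.edgeSet C (l.map Prod.fst) = expected C b v₂ (l.map Prod.snd) := by omega
  exact ⟨h3, expected_step_eq hM hC h12 hN (by omega)⟩

/-- An optimal remainder that starts outside `C` and avoids its base avoids `C`. -/
theorem AugTail.avoids {M : G.Subgraph} (hM : M.IsMatching) {C : Set V} {b : V}
    (hC : Based M C b) {a : V} {l : List (Sym2 V × V)} (h : AugTail M a l)
    (hbal : defect M.edgeSet C (l.map Prod.fst) = expected C b a (l.map Prod.snd))
    (ha : a ∉ C) (hb : b ∉ l.map Prod.snd) : ∀ v ∈ l.map Prod.snd, v ∉ C := by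
  induction h with
  | single a v hadj hnM hfree =>
    simp only [List.map_cons, List.map_nil, List.mem_singleton] at hb ⊢
    rintro u rfl hu
    exact hb (hC.eq_of_free hu hfree).symm
  | step a v₁ v₂ l hadj hnM h12 hN htail ih =>
    obtain ⟨h1, -, -, h2⟩ := AugTail.balanced_step hM hC hnM h12 hN htail hbal
    obtain ⟨h3, h4⟩ := h2 ha hb
    simp only [List.map_cons, List.mem_cons, not_or] at hb ⊢
    rintro u (rfl | rfl | hu)
    · exact h3
    · exact h4
    · exact ih h1 h4 hb.2.2 u hu

/-- The steps of the image of a path under `π`. -/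
noncomputable def imageSteps {N : Type*} (π : V → N) (l : List (Sym2 V × V)) :
    List (Sym2 V × N) :=
  l.filterMap (fun s => if (s.1.map π).IsDiag then none else some (s.1, π s.2))

theorem imageSteps_cons_of_eq {N : Type*} {π : V → N} {a v : V} (h : π a = π v)
    (l : List (Sym2 V × V)) : imageSteps π ((s(a, v), v) :: l) = imageSteps π l := by
  simp [imageSteps, h]

theorem imageSteps_cons_of_ne {N : Type*} {π : V → N} {a v : V} (h : π a ≠ π v)
    (l : List (Sym2 V × V)) :
    imageSteps π ((s(a, v), v) :: l) = (s(a, v), π v) :: imageSteps π l := by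
  simp [imageSteps, h]

theorem imageSteps_snd_subset {N : Type*} {π : V → N} {l : List (Sym2 V × V)} {n : N}
    (h : n ∈ (imageSteps π l).map Prod.snd) : ∃ v ∈ l.map Prod.snd, π v = n := by
  simp only [imageSteps, List.mem_map, List.mem_filterMap] at h
  obtain ⟨q, ⟨p, hp, hq⟩, rfl⟩ := h
  split_ifs at hq
  rw [Option.some.injEq] at hq
  subst hq
  exact ⟨p.2, List.mem_map_of_mem hp, rfl⟩

/-- The image of the remainder of an optimal augmenting path is alternating and simple. -/
theorem AugTail.image {M : G.Subgraph} (hM : M.IsMatching) {N : Type*} {π : V → N} {bs : V → V}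
    (hbs : ∀ u v, π u = π v → bs u = bs v) (hπ : ∀ c, Based M {u | π u = π c} (bs c)) {a : V}
    {l : List (Sym2 V × V)} (h : AugTail M a l)
    (hbal : ∀ c, defect M.edgeSet {u | π u = π c} (l.map Prod.fst) =
      expected {u | π u = π c} (bs c) a (l.map Prod.snd)) :
    (bs a ∈ l.map Prod.snd → Alt M.edgeSet true ((imageSteps π l).map Prod.fst)) ∧
    (bs a ∉ l.map Prod.snd → Alt M.edgeSet false ((imageSteps π l).map Prod.fst)) ∧
    (π a :: (imageSteps π l).map Prod.snd).Nodup := by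
  -- The first image edge is the one by which the path leaves the node of `a`: it is matched when
  -- the base is still ahead, and unmatched otherwise.
  induction h with
  | single a v hadj hnM hfree =>
    have hv : v = bs v := (hπ v).eq_of_free rfl hfree
    by_cases hav : π a = π v
    · have : bs a = v := (hbs a v hav).trans hv.symm
      rw [imageSteps_cons_of_eq hav]
      simp [imageSteps, this]
    · have : bs a ≠ v := fun h => hav ((show π (bs a) = π a from (hπ a).mem).symm.trans (by rw [h]))
      rw [imageSteps_cons_of_ne hav]
      simp [imageSteps, this, hav, hnM]
  | step a v₁ v₂ l hadj hnM h12 hN htail ih =>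
    have hstep := fun c => AugTail.balanced_step hM (hπ c) hnM h12 hN htail (hbal c)
    obtain ⟨ih1, ih2, ih3⟩ := ih fun c => (hstep c).1
    -- A matched edge that survives in the image leaves both of its nodes at their bases.
    have hbase : ∀ u v, M.Adj u v → π u ≠ π v → u = bs u := by
      intro u v huv hne
      by_contra h
      exact hne ((hπ u).mem_of_adj hM huv rfl h).symm
    have havoid : ∀ c, π v₂ ≠ π c → bs c ∉ l.map Prod.snd →
        π c ∉ (imageSteps π l).map Prod.snd := by
      intro c h1 h2 h3
      obtain ⟨v, hv, hvc⟩ := imageSteps_snd_subset h3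
      exact htail.avoids hM (hπ c) (hstep c).1 h1 h2 v hv hvc
    simp only [List.nodup_cons, List.mem_cons, not_or] at hN
    obtain ⟨⟨ha1, ha2, ha3⟩, ⟨h121, h13⟩, h23, -⟩ := hN
    by_cases e1 : π a = π v₁
    · rw [imageSteps_cons_of_eq e1]
      by_cases e2 : π v₁ = π v₂
      · rw [imageSteps_cons_of_eq e2]
        have hb : bs a = bs v₂ := hbs _ _ (e1.trans e2)
        have n1 : bs a ≠ v₁ := by
          intro h
          exact (hπ a).not_adj v₂ (e1.trans e2).symm (h ▸ h12)
        have n2 : bs a ≠ v₂ := by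
          intro h
          exact (hπ a).not_adj v₁ e1.symm (h ▸ h12.symm)
        rw [hb] at n1 n2 ⊢
        simp only [List.map_cons, List.mem_cons, n1, n2, false_or]
        rw [e1.trans e2]
        exact ⟨ih1, ih2, ih3⟩
      · rw [imageSteps_cons_of_ne e2]
        have hb1 : v₁ = bs v₁ := hbase v₁ v₂ h12 e2
        have hb2 : v₂ = bs v₂ := hbase v₂ v₁ h12.symm (Ne.symm e2)
        have hba : bs a = v₁ := (hbs _ _ e1).trans hb1.symm
        have hn2 : bs v₂ ∉ l.map Prod.snd := hb2 ▸ h23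
        refine ⟨fun _ => ?_, fun h => absurd (by simp [hba]) h, ?_⟩
        · simp only [List.map_cons, alt_cons]
          exact ⟨by simpa using h12, ih2 hn2⟩
        · rw [List.map_cons, List.nodup_cons, List.mem_cons, not_or]
          refine ⟨⟨fun h => e2 (e1.symm.trans h), ?_⟩, ih3⟩
          exact havoid a (fun h => e2 (h.trans e1).symm) (by rwa [hba])
    · rw [imageSteps_cons_of_ne e1]
      -- Having left the node of `a` by an unmatched edge, the path no longer has its base ahead, so
      -- it cannot visit that node again.
      obtain ⟨f1, f2⟩ := (hstep a).2.1 rfl (fun h => e1 h.symm)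
      have f1 : π v₂ ≠ π a := f1
      have f3 : bs a ∉ l.map Prod.snd := fun h => f2 (by simp [h])
      have f4 := havoid a f1 f3
      by_cases e2 : π v₁ = π v₂
      · rw [imageSteps_cons_of_eq e2]
        -- The node is entered by an unmatched edge away from its base, so the path must still leave
        -- it, or end, at the base.
        have g : bs v₁ ∈ l.map Prod.snd := (hstep v₁).2.2.1 e1 rfl e2.symm
        refine ⟨fun h => absurd h f2, fun _ => ?_, ?_⟩
        · simp only [List.map_cons, alt_cons]
          exact ⟨by simpa using hnM, ih1 (hbs _ _ e2 ▸ g)⟩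
        · rw [List.map_cons, List.nodup_cons, List.mem_cons, not_or, e2]
          exact ⟨⟨fun h => e1 (h.trans e2.symm), f4⟩, ih3⟩
      · rw [imageSteps_cons_of_ne e2]
        have hb1 : v₁ = bs v₁ := hbase v₁ v₂ h12 e2
        have hb2 : v₂ = bs v₂ := hbase v₂ v₁ h12.symm (Ne.symm e2)
        refine ⟨fun h => absurd h f2, fun _ => ?_, ?_⟩
        · simp only [List.map_cons, alt_cons]
          exact ⟨by simpa using hnM, by simpa using h12, ih2 (hb2 ▸ h23)⟩
        · simp only [List.map_cons]
          rw [List.nodup_cons, List.nodup_cons, List.mem_cons, List.mem_cons, List.mem_cons,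
            not_or, not_or, not_or]
          exact ⟨⟨e1, Ne.symm f1, f4⟩, ⟨e2, havoid v₁ (Ne.symm e2) (hb1 ▸ h13)⟩, ih3⟩

end Search

section Search

variable {V : Type*} {G : SimpleGraph V} {M : G.Subgraph} {s : SearchState V} {par : V → V}
  {rk : V → ℕ} {y₀ : ℝ}

/-! ### Optimality of augmenting paths -/

/-- The edges that satisfy their dual constraint with equality. -/
def tightEdges (M : G.Subgraph) (s : SearchState V) : Set (Sym2 V) := {e | edgeSlack M s e = 0}

/-- The positive blossoms as a finite family. -/
noncomputable def positiveFamily (s : SearchState V) : Finset (Finset V) :=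
  s.blossoms.filter (fun B => 0 < s.z B)

theorem coe_positiveFamily (s : SearchState V) :
    (positiveFamily s : Set (Finset V)) = s.positiveBlossoms := by
  ext B
  simp [positiveFamily, SearchState.positiveBlossoms]

theorem SearchInv.laminar_positive (hI : SearchInv M s par rk) : Laminar s.positiveBlossoms :=
  fun B hB C hC => hI.laminar B hB.1 C hC.1

/-- This is the only form in which search walks are used from here on: edges of the search structure
are tight, and positive blossoms are blossoms. -/
theorem GoodWalk.tight (hD : DualInv M s y₀) {S : Set V} {st : Bool} {a b : V} {w : G.Walk a b}
    (h : GoodWalk M s.edges s.blossoms S st w) :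
    GoodWalk M (tightEdges M s) (positiveFamily s) S st w :=
  { h with
    edges_mem := by
      intro e he
      have hG := w.edges_subset_edgeSet he
      have hE := h.edges_mem e he
      induction e with
      | _ u v => exact hD.slack_edges u v hG hE
    balanced := fun B hB => h.balanced B (Finset.mem_filter.1 hB).1 }

theorem SearchInv.exists_based (hI : SearchInv M s par rk) {B : Finset V} (hB : B ∈ s.blossoms) :
    ∃ b, Based M (B : Set V) b := by
  obtain ⟨b, hb, h1, h2⟩ := hI.core B hB
  refine ⟨b, hb, h1, fun v hv hne => ?_⟩
  obtain ⟨w, hw⟩ := h2 v hv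
  exact hw.exists_mate (Ne.symm hne)

/-- If the free start lies in `C` it is the base, which simplicity keeps from recurring; so the
allowance `expected` is 0. -/
theorem IsAugmentingPath.defect_nonpos (hM : M.IsMatching) {C : Set V} {b : V}
    (hC : Based M C b) {P : EdgePath V (Sym2 V)}
    (h : IsAugmentingPath (Graph.ofSimpleGraph G) M.edgeSet P) :
    expected C b P.start (P.steps.map Prod.snd) = 0 ∧ defect M.edgeSet C P.edges ≤ 0 := by
  obtain ⟨-, hN, -, -, hs, -⟩ := isAugmentingPath_iff.1 h
  have h1 := h.augTail.defect_le hM hC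
  have h2 : expected C b P.start (P.steps.map Prod.snd) = 0 := by
    unfold expected
    rw [if_neg]
    rintro ⟨h3, h4⟩
    rw [← hC.eq_of_free h3 (isFree_ofSimpleGraph_iff.1 hs)] at h4
    exact (List.nodup_cons.1 hN).1 h4
  exact ⟨h2, h1.trans h2.le⟩

/-- Weak duality with complementary slackness: every correction to `2 * y₀` is nonpositive, so
equality makes each of them vanish. -/
theorem IsAugmentingPath.pathWeight_le (hM : M.IsMatching) (hI : SearchInv M s par rk)
    (hD : DualInv M s y₀) {P : EdgePath V (Sym2 V)}
    (h : IsAugmentingPath (Graph.ofSimpleGraph G) M.edgeSet P) :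
    pathWeight M.edgeSet P ≤ 2 * y₀ ∧ (pathWeight M.edgeSet P = 2 * y₀ →
      (∀ e ∈ P.edges, e ∈ tightEdges M s) ∧
      ∀ B ∈ positiveFamily s, defect M.edgeSet (B : Set V) P.edges = 0) := by
  have hL := (isAugmentingPath_iff.1 h).1
  have hslack := edgeSign_mul_slack_nonneg hD hL
  have hdef : ∀ B ∈ s.blossoms, s.z B * defect M.edgeSet (B : Set V) P.edges ≤ 0 := by
    intro B hB
    obtain ⟨b, hb⟩ := hI.exists_based hB
    have := (h.defect_nonpos hM hb).2
    exact mul_nonpos_of_nonneg_of_nonpos (hD.z_nonneg B) (by exact_mod_cast this)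
  have h0 : ∀ t ∈ P.edges.map (fun e => edgeSign M.edgeSet e * edgeSlack M s e), 0 ≤ t := by
    intro t ht
    obtain ⟨e, he, rfl⟩ := List.mem_map.1 ht
    exact (hslack e he).1
  have h1 := List.sum_nonneg h0
  have h2 := Finset.sum_nonpos hdef
  rw [h.pathWeight_eq hD]
  refine ⟨by linarith, fun heq => ⟨fun e he => (hslack e he).2 ?_, fun B hB => ?_⟩⟩
  · have h3 := List.single_le_sum h0 _ (List.mem_map_of_mem he)
    have h4 := (hslack e he).1
    linarith
  · obtain ⟨hB1, hB2⟩ := Finset.mem_filter.1 hB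
    have h3 := (Finset.sum_eq_zero_iff_of_nonpos hdef).1 (by linarith) B hB1
    rcases mul_eq_zero.1 h3 with h3 | h3
    · exact absurd h3 hB2.ne'
    · exact_mod_cast h3

theorem OptWalk.pathWeight_eq (hD : DualInv M s y₀) {S : Set V} {a b : V} {w : G.Walk a b}
    (h : OptWalk M (tightEdges M s) (positiveFamily s) S w) (ha : ∀ u, ¬ M.Adj a u)
    (hb : ∀ u, ¬ M.Adj b u) : pathWeight M.edgeSet ⟨a, walkSteps w⟩ = 2 * y₀ := by
  have hedges : EdgePath.edges ⟨a, walkSteps w⟩ = w.edges := walkSteps_fst w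
  rw [(h.isAugmentingPath ha hb).pathWeight_eq hD, hedges, Finset.sum_eq_zero, List.sum_eq_zero]
  · ring
  · intro t ht
    obtain ⟨e, he, rfl⟩ := List.mem_map.1 ht
    rw [show edgeSlack M s e = 0 from h.edges_mem e he, mul_zero]
  · intro B hB
    rcases (hD.z_nonneg B).eq_or_lt with h0 | h0
    · rw [← h0, zero_mul]
    · rw [h.balanced B (Finset.mem_filter.2 ⟨hB, h0⟩)]
      simp

theorem isBase_of_free (hI : SearchInv M s par rk) {r : V} (hr : ∀ u, ¬ M.Adj r u) :
    IsBase M s r := by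
  obtain ⟨b, hb, hbase⟩ := hI.exists_isBase r
  rwa [SearchInv.eq_base hbase hb.symm fun v hv => absurd hv (hr v)]

/-- The bound is attained by descending from two free roots to the ends of the tight edge found. The
two walks are disjoint because a common node would connect the two search trees. -/
theorem exists_optimal (hM : M.IsMatching) (hI : SearchInv M s par rk) (hD : DualInv M s y₀)
    (h : s.AugmentPossible M) :
    ∃ P, IsAugmentingPath (Graph.ofSimpleGraph G) M.edgeSet P ∧
      pathWeight M.edgeSet P = 2 * y₀ := by
  obtain ⟨x, y, ⟨hadj, ht, hx, hne⟩, hy, hreach⟩ := h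
  obtain ⟨r₁, ns₁, hr₁, hasc₁, hreach₁⟩ := hI.exists_root_ascent hM _ x hx rfl
  obtain ⟨r₂, ns₂, hr₂, hasc₂, hreach₂⟩ := hI.exists_root_ascent hM _ y hy rfl
  obtain ⟨w₁, hw₁⟩ := hI.exists_descent hM (isBase_of_free hI hr₁) hasc₁
  obtain ⟨w₂, hw₂⟩ := hI.exists_descent hM (isBase_of_free hI hr₂) hasc₂
  have hopt := (hw₁.tight hD).optWalk (hw₂.tight hD) hadj (hI.not_adj_of_outer hx hy hne)
    (tight_iff.1 ht)
    (fun B hB h1 h2 => hne (hI.top_eq_of_mem (Finset.mem_filter.1 hB).1 h1 h2))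
    (fun u h1 h2 => hreach ((hreach₁ u h1).trans (hreach₂ u h2).symm))
  exact ⟨_, hopt.isAugmentingPath hr₁ hr₂, hopt.pathWeight_eq hD hr₁ hr₂⟩

theorem isSap_iff_pathWeight (hM : M.IsMatching) (hI : SearchInv M s par rk)
    (hD : DualInv M s y₀) (h : s.AugmentPossible M) {P : EdgePath V (Sym2 V)} :
    IsSap (Graph.ofSimpleGraph G) M.edgeSet P ↔
      IsAugmentingPath (Graph.ofSimpleGraph G) M.edgeSet P ∧
        pathWeight M.edgeSet P = 2 * y₀ := by
  rw [← isMaxWeightAugmentingPath_iff]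
  constructor
  · rintro ⟨hP, hmax⟩
    obtain ⟨Q, hQ, hQw⟩ := exists_optimal hM hI hD h
    exact ⟨hP, le_antisymm (hP.pathWeight_le hM hI hD).1 (hQw ▸ hmax Q hQ)⟩
  · rintro ⟨hP, hPw⟩
    exact ⟨hP, fun Q hQ => hPw ▸ (hQ.pathWeight_le hM hI hD).1⟩

/-! ### The nodes of `H` -/

theorem graphH_isLink {e : Sym2 V} {p q : Quotient (contraction s.positiveBlossoms)} :
    (graphH M s).IsLink e p q ↔ ∃ u v, G.Adj u v ∧ e = s(u, v) ∧ e ∈ tightEdges M s ∧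
      s.toH u = p ∧ s.toH v = q ∧ p ≠ q := by
  unfold graphH
  rw [Graph.restrict_isLink, Graph.map_isLink]
  constructor
  · rintro ⟨⟨u', v', he, ht, hne⟩, u, v, hl, hu, hv⟩
    obtain ⟨hadj, rfl⟩ := isLink_ofSimpleGraph.1 hl
    refine ⟨u, v, hadj, rfl, ?_, hu, hv, ?_⟩
    · rw [he]
      exact tight_iff.1 ht
    · rw [Sym2.eq_iff] at he
      rw [← hu, ← hv]
      rcases he with ⟨rfl, rfl⟩ | ⟨rfl, rfl⟩
      · exact hne
      · exact hne.symm
  · rintro ⟨u, v, hadj, rfl, ht, rfl, rfl, hne⟩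
    exact ⟨⟨u, v, rfl, tight_iff.2 ht, hne⟩, u, v, isLink_ofSimpleGraph.2 ⟨hadj, rfl⟩, rfl, rfl⟩

theorem toH_eq_cases (hI : SearchInv M s par rk) (c : V) :
    (∃ B ∈ positiveFamily s, ∀ u, s.toH u = s.toH c ↔ u ∈ B) ∨
      ∀ u, s.toH u = s.toH c ↔ u = c := by
  have hfin : s.positiveBlossoms.Finite := by
    rw [← coe_positiveFamily]
    exact Finset.finite_toSet _
  rcases node_eq_member_or_singleton hI.laminar_positive hfin c with ⟨B, hB, -, h⟩ | h
  · rw [← coe_positiveFamily] at hB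
    exact Or.inl ⟨B, hB, h⟩
  · exact Or.inr h

theorem toH_eq_of_mem (hI : SearchInv M s par rk) {B : Finset V} (hB : B ∈ positiveFamily s)
    {u v : V} (hu : u ∈ B) (hv : v ∈ B) : s.toH u = s.toH v := by
  refine (node_eq_iff hI.laminar_positive).2 (Or.inr ⟨B, ?_, hu, hv⟩)
  rw [← coe_positiveFamily]
  exact hB

/-- `b` is the base of the node `n` of `H`. -/
structure NodeBase (M : G.Subgraph) (s : SearchState V)
    (n : Quotient (contraction s.positiveBlossoms)) (b : V) : Prop where
  toH_eq : s.toH b = n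
  not_adj : ∀ v, s.toH v = n → ¬ M.Adj b v
  exists_walk : ∀ x, s.toH x = n → ∃ w : G.Walk b x,
    GoodWalk M (tightEdges M s) (positiveFamily s) {u | s.toH u = n} false w

theorem exists_nodeBase (hI : SearchInv M s par rk) (hD : DualInv M s y₀)
    (n : Quotient (contraction s.positiveBlossoms)) : ∃ b, NodeBase M s n b := by
  obtain ⟨c, rfl⟩ : ∃ c, s.toH c = n := Quotient.exists_rep n
  rcases toH_eq_cases hI c with ⟨B, hB, h⟩ | h
  · obtain ⟨b, hb, h1, h2⟩ := hI.core B (Finset.mem_filter.1 hB).1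
    refine ⟨b, (h b).2 hb, fun v hv => h1 v ((h v).1 hv), fun x hx => ?_⟩
    obtain ⟨w, hw⟩ := h2 x ((h x).1 hx)
    exact ⟨w, (hw.tight hD).mono subset_rfl fun u hu => (h u).2 hu⟩
  · refine ⟨c, rfl, fun v hv => ?_, fun x hx => ?_⟩
    · rw [(h v).1 hv]
      exact fun h => h.ne rfl
    · rw [(h x).1 hx]
      exact ⟨SimpleGraph.Walk.nil, GoodWalk.nil rfl⟩

theorem NodeBase.based {n : Quotient (contraction s.positiveBlossoms)} {b : V}
    (h : NodeBase M s n b) : Based M {u | s.toH u = n} b where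
  mem := h.toH_eq
  not_adj := h.not_adj
  exists_mate v hv hne := by
    obtain ⟨w, hw⟩ := h.exists_walk v hv
    exact hw.exists_mate (Ne.symm hne)

/-- Vertices other than the base are matched inside the node. A matched edge at the base is tight
and leaves the node, so it survives in `graphH M s`. -/
theorem NodeBase.isFree_iff (hM : M.IsMatching) (hD : DualInv M s y₀)
    {n : Quotient (contraction s.positiveBlossoms)} {b : V} (h : NodeBase M s n b) :
    IsFree (graphH M s) M.edgeSet n ↔ ∀ u, ¬ M.Adj b u := by
  constructor
  · rintro ⟨-, hfree⟩ u hu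
    refine hfree s(b, u) hu ⟨s.toH u, graphH_isLink.2 ⟨b, u, hu.adj_sub, rfl,
      hD.slack_matched b u hu, h.toH_eq, rfl, fun hn => h.not_adj u hn.symm hu⟩⟩
  · intro hfree
    refine ⟨⟨b, by simp [Graph.ofSimpleGraph], h.toH_eq⟩, ?_⟩
    rintro e he ⟨q, hq⟩
    obtain ⟨u, v, -, rfl, -, hu, rfl, hne⟩ := graphH_isLink.1 hq
    refine hne ?_
    have hub : u ≠ b := by
      rintro rfl
      exact hfree v he
    exact (h.based.mem_of_adj hM he hu hub).symm

theorem NodeBase.eq_of_adj (hM : M.IsMatching)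
    {n : Quotient (contraction s.positiveBlossoms)} {b u v : V} (h : NodeBase M s n b)
    (huv : M.Adj u v) (hu : s.toH u = n) (hv : s.toH v ≠ n) : u = b := by
  by_contra hne
  exact hv (h.based.mem_of_adj hM huv hu hne)

/-! ### Images of shortest augmenting paths -/

theorem linked_image {a : V} {l : List (Sym2 V × V)}
    (hL : Linked (Graph.ofSimpleGraph G) a l)
    (ht : ∀ e ∈ l.map Prod.fst, e ∈ tightEdges M s) :
    Linked (graphH M s) (s.toH a) (imageSteps s.toH l) ∧
      (s.toH a :: (imageSteps s.toH l).map Prod.snd).getLast (by simp) =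
        s.toH ((a :: l.map Prod.snd).getLast (by simp)) := by
  induction l generalizing a with
  | nil => exact ⟨trivial, rfl⟩
  | cons p l ih =>
    obtain ⟨e, v⟩ := p
    obtain ⟨h1, h2⟩ := hL
    obtain ⟨hadj, rfl⟩ := isLink_ofSimpleGraph.1 h1
    obtain ⟨ih1, ih2⟩ := ih h2 fun e he => ht e (by simp [he])
    have hlast : (a :: v :: l.map Prod.snd).getLast (by simp) =
        (v :: l.map Prod.snd).getLast (by simp) := List.getLast_cons (by simp)
    simp only [List.map_cons, hlast]
    by_cases hav : s.toH a = s.toH v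
    · simp only [imageSteps_cons_of_eq hav, hav]
      exact ⟨ih1, ih2⟩
    · simp only [imageSteps_cons_of_ne hav, List.map_cons]
      refine ⟨⟨graphH_isLink.2 ⟨a, v, hadj, rfl, ht _ (by simp), rfl, rfl, hav⟩, ih1⟩, ?_⟩
      rw [← ih2]
      exact List.getLast_cons (by simp)

/-- Maximum weight makes the path tight, so its surviving edges lie in `graphH M s`, and balanced in
every node, so `AugTail.image` applies. -/
theorem isAugmentingPath_image (hM : M.IsMatching) (hI : SearchInv M s par rk)
    (hD : DualInv M s y₀) {P : EdgePath V (Sym2 V)}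
    (hP : IsAugmentingPath (Graph.ofSimpleGraph G) M.edgeSet P)
    (hPw : pathWeight M.edgeSet P = 2 * y₀) :
    IsAugmentingPath (graphH M s) M.edgeSet (P.image s.toH) := by
  obtain ⟨htight, hbal⟩ := (hP.pathWeight_le hM hI hD).2 hPw
  obtain ⟨hL, hN, hA, hO, hs, hf⟩ := isAugmentingPath_iff.1 hP
  rw [isFree_ofSimpleGraph_iff] at hs hf
  choose bq hbq using exists_nodeBase hI hD
  have hbased : ∀ c, Based M {u | s.toH u = s.toH c} (bq (s.toH c)) := fun c =>
    (hbq (s.toH c)).based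
  have hbal' : ∀ c, defect M.edgeSet {u | s.toH u = s.toH c} P.edges = 0 := by
    intro c
    rcases toH_eq_cases hI c with ⟨B, hB, h⟩ | h
    · rw [← hbal B hB]
      congr 1
      ext u
      exact h u
    -- A node with one vertex contains no edge of a simple graph.
    · refine defect_eq_zero fun e he hin => ?_
      have hG : ∀ e ∈ P.edges, e ∈ G.edgeSet := by
        unfold EdgePath.edges
        revert hL
        generalize P.start = a
        induction P.steps generalizing a with
        | nil => simp
        | cons p l ih =>
          obtain ⟨e, v⟩ := p
          rintro ⟨h1, h2⟩ e' he'
          rw [List.map_cons, List.mem_cons] at he'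
          rcases he' with rfl | he'
          · obtain ⟨hadj, rfl⟩ := isLink_ofSimpleGraph.1 h1
            exact hadj
          · exact ih v h2 e' he'
      have := hG e he
      induction e with
      | _ u v =>
        rw [inside_mk] at hin
        exact G.ne_of_adj this (((h u).1 hin.1).trans ((h v).1 hin.2).symm)
  obtain ⟨-, himg, hnd⟩ := hP.augTail.image hM (π := s.toH) (bs := fun c => bq (s.toH c))
    (fun u v h => by simp only [h]) hbased
    (fun c => (hbal' c).trans (hP.defect_nonpos hM (hbased c)).1.symm)
  have hstart : bq (s.toH P.start) = P.start := ((hbased P.start).eq_of_free rfl hs).symm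
  obtain ⟨hlink, hlast⟩ := linked_image hL htight
  have hfree : ∀ v, (∀ u, ¬ M.Adj v u) → IsFree (graphH M s) M.edgeSet (s.toH v) := by
    intro v hv
    rw [(hbq (s.toH v)).isFree_iff hM hD, ← (hbased v).eq_of_free rfl hv]
    exact hv
  have halt := himg (by rw [hstart]; exact (List.nodup_cons.1 hN).1)
  refine ⟨⟨⟨(hfree _ hs).1, hlink, hnd⟩, halt.isChain⟩, hfree _ hs, ?_, ?_⟩
  · have := hfree _ hf
    rwa [← hlast] at this
  · intro heq
    have heq : s.toH P.start = s.toH P.finish := heq.trans hlast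
    -- A free vertex is the base of its node, so the node determines it and distinct ends have
    -- distinct images.
    have hfin : bq (s.toH P.finish) = P.finish := ((hbased P.finish).eq_of_free rfl hf).symm
    exact hP.2.2.2 (by rw [← hstart, ← hfin, heq])

/-! ### Lifting augmenting paths of `H` -/

theorem imageSteps_append {N : Type*} (π : V → N) (l l' : List (Sym2 V × V)) :
    imageSteps π (l ++ l') = imageSteps π l ++ imageSteps π l' := by
  simp [imageSteps]

theorem imageSteps_walkSteps_eq_nil {N : Type*} {π : V → N} {n : N} {a b : V} {w : G.Walk a b}
    (h : ∀ u ∈ w.support, π u = n) : imageSteps π (walkSteps w) = [] := by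
  induction w with
  | nil => rfl
  | cons hadj p ih =>
    rw [SimpleGraph.Walk.support_cons] at h
    rw [walkSteps, imageSteps_cons_of_eq]
    · exact ih fun u hu => h u (List.mem_cons_of_mem _ hu)
    · rw [h _ List.mem_cons_self, h _ (List.mem_cons_of_mem _ p.start_mem_support)]

/-- Going from one base to an end of `e`, across `e`, and back from its other end to the second base
adds only edges inside the two nodes, which the image deletes. -/
theorem exists_crossing_walk (hI : SearchInv M s par rk)
    {n n' : Quotient (contraction s.positiveBlossoms)} {c c' : V} (hc : NodeBase M s n c)
    (hc' : NodeBase M s n' c') {e : Sym2 V} (hlink : (graphH M s).IsLink e n n')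
    (he : e ∉ M.edgeSet) :
    ∃ w : G.Walk c c', OptWalk M (tightEdges M s) (positiveFamily s)
      ({u | s.toH u = n} ∪ {u | s.toH u = n'}) w ∧ imageSteps s.toH (walkSteps w) = [(e, n')] := by
  obtain ⟨x, v, hadj, rfl, ht, hx, hv, hne⟩ := graphH_isLink.1 hlink
  obtain ⟨w, hw⟩ := hc.exists_walk x hx
  obtain ⟨w', hw'⟩ := hc'.exists_walk v hv
  refine ⟨_, hw.optWalk hw' hadj he ht ?_ ?_, ?_⟩
  · intro B hB h1 h2
    exact hne (hx.symm.trans ((toH_eq_of_mem hI hB h1 h2).trans hv))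
  · rintro u rfl hu
    exact hne hu
  · rw [walkSteps_append, imageSteps_append, imageSteps_walkSteps_eq_nil hw.support_subset,
      walkSteps, imageSteps_cons_of_ne (by rwa [hx, hv]), hv, imageSteps_walkSteps_eq_nil
        (n := n') fun u hu => hw'.support_subset u (by simpa using hu)]
    rfl

/-- Lifting removes an unmatched and a matched edge at a time: the first becomes a crossing walk
between bases, and the second already joins bases. Pieces are disjoint because the nodes of the path
are distinct. -/
theorem exists_lift (hM : M.IsMatching) (hI : SearchInv M s par rk) (hD : DualInv M s y₀)
    (k : ℕ) : ∀ (n : Quotient (contraction s.positiveBlossoms))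
      (l : List (Sym2 V × Quotient (contraction s.positiveBlossoms))), l.length = k →
      ∀ c, NodeBase M s n c → Linked (graphH M s) n l → (n :: l.map Prod.snd).Nodup →
      Alt M.edgeSet false (l.map Prod.fst) → Odd l.length →
      IsFree (graphH M s) M.edgeSet ((n :: l.map Prod.snd).getLast (by simp)) →
      ∃ v, ∃ w : G.Walk c v, (∀ u, ¬ M.Adj v u) ∧
        OptWalk M (tightEdges M s) (positiveFamily s) {u | s.toH u ∈ n :: l.map Prod.snd} w ∧
        imageSteps s.toH (walkSteps w) = l := by
  induction k using Nat.strong_induction_on with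
  | _ k ih =>
  intro n l hk c hc hL hN hA hO hF
  match l, hk, hL, hN, hA, hO, hF with
  | [(e, n')], _, hL, _, hA, _, hF =>
    obtain ⟨c', hc'⟩ := exists_nodeBase hI hD n'
    obtain ⟨w, hw, himg⟩ := exists_crossing_walk hI hc hc' hL.1 (by simpa using hA)
    refine ⟨c', w, (hc'.isFree_iff hM hD).1 (by simpa using hF),
      { hw with support_subset := fun u hu => ?_ }, himg⟩
    rcases hw.support_subset u hu with h | h
    · simp [show s.toH u = n from h]
    · simp [show s.toH u = n' from h]
  | (e₁, n₁) :: (e₂, n₂) :: l, hk, hL, hN, hA, hO, hF =>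
    obtain ⟨h1, h2, h3⟩ := hL
    simp only [List.map_cons, alt_cons, Bool.not_false, Bool.not_true] at hA
    obtain ⟨p, q, -, rfl, ht, hp, hq, hne⟩ := graphH_isLink.1 h2
    have hpq : M.Adj p q := by simpa using hA.2.1
    obtain ⟨c₁, hc₁⟩ := exists_nodeBase hI hD n₁
    obtain ⟨c₂, hc₂⟩ := exists_nodeBase hI hD n₂
    -- The ends of a matched edge between distinct nodes are their bases, so the pieces fit together
    -- without further walks.
    obtain rfl : p = c₁ := hc₁.eq_of_adj hM hpq hp fun h => hne (h.symm.trans hq)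
    obtain rfl : q = c₂ := hc₂.eq_of_adj hM hpq.symm hq fun h => hne (hp.symm.trans h)
    obtain ⟨w, hw, himg⟩ := exists_crossing_walk hI hc hc₁ h1 (by simpa using hA.1)
    simp only [List.map_cons, List.nodup_cons, List.mem_cons, not_or] at hN
    obtain ⟨⟨hn1, hn2, hn3⟩, ⟨hn12, hn13⟩, hn23, hNl⟩ := hN
    obtain ⟨v, w', hv, hw', himg'⟩ := ih l.length (by simp at hk; omega) n₂ l rfl q hc₂ h3
      (List.nodup_cons.2 ⟨hn23, hNl⟩) hA.2.2 (by simpa [Nat.odd_add] using hO) (by simpa using hF)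
    have happ := hw.append hw' hpq ht
      (fun B hB hpB hqB => hne (hp.symm.trans ((toH_eq_of_mem hI hB hpB hqB).trans hq)))
      (by
        intro u hu hu'
        have hu' : s.toH u ∈ n₂ :: l.map Prod.snd := hu'
        rw [List.mem_cons] at hu'
        rcases hu with hu | hu <;> rw [show s.toH u = _ from hu] at hu' <;> tauto)
    refine ⟨v, _, hv, { happ with support_subset := fun u hu => ?_ }, ?_⟩
    · rcases happ.support_subset u hu with (h | h) | h
      · simp [show s.toH u = n from h]
      · simp [show s.toH u = n₁ from h]
      · have h : s.toH u ∈ n₂ :: l.map Prod.snd := h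
        simp only [Set.mem_ofPred_eq, List.map_cons, List.mem_cons] at h ⊢
        tauto
    · rw [walkSteps_append, imageSteps_append, himg, walkSteps,
        imageSteps_cons_of_ne (by rwa [hp, hq]), himg', hq]
      rfl

theorem augmentingPaths_graphH (hM : M.IsMatching) (hI : SearchInv M s par rk)
    (hD : DualInv M s y₀) (h : s.AugmentPossible M) :
    {Q | IsAugmentingPath (graphH M s) M.edgeSet Q} =
      EdgePath.image s.toH '' {P | IsSap (Graph.ofSimpleGraph G) M.edgeSet P} := by
  ext Q
  simp only [Set.mem_ofPred_eq, Set.mem_image, isSap_iff_pathWeight hM hI hD h]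
  constructor
  · intro hQ
    obtain ⟨hL, hN, hA, hO, hs, hf⟩ := isAugmentingPath_iff.1 hQ
    obtain ⟨c, hc⟩ := exists_nodeBase hI hD Q.start
    obtain ⟨v, w, hv, hw, himg⟩ := exists_lift hM hI hD _ _ _ rfl c hc hL hN hA hO hf
    have hcfree := (hc.isFree_iff hM hD).1 hs
    refine ⟨⟨c, walkSteps w⟩, ⟨hw.isAugmentingPath hcfree hv, hw.pathWeight_eq hD hcfree hv⟩, ?_⟩
    exact EdgePath.ext hc.toH_eq himg
  · rintro ⟨P, ⟨hP, hPw⟩, rfl⟩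
    exact isAugmentingPath_image hM hI hD hP hPw

end Search

end CardMatching

theorem mainTheorem4 {V : Type*} [Fintype V] (G : SimpleGraph V) (M : G.Subgraph)
    (hM : M.IsMatching) :
    (∀ P, CardMatching.IsAugmentingPath (Graph.ofSimpleGraph G) M.edgeSet P →
      (P.length : ℝ) = -CardMatching.pathWeight M.edgeSet P + 1) ∧
    (∀ P, CardMatching.IsMaxWeightAugmentingPath (Graph.ofSimpleGraph G) M.edgeSet P ↔
      CardMatching.IsSap (Graph.ofSimpleGraph G) M.edgeSet P) ∧
    (∀ s : CardMatching.SearchState V, CardMatching.IsSuccessfulFinalState M s →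
      {Q | CardMatching.IsAugmentingPath (CardMatching.graphH M s) M.edgeSet Q} =
        CardMatching.EdgePath.image s.toH ''
          {P | CardMatching.IsSap (Graph.ofSimpleGraph G) M.edgeSet P}) := by
  refine ⟨fun P hP => hP.length_eq, fun P => CardMatching.isMaxWeightAugmentingPath_iff, ?_⟩
  rintro s ⟨hsearch, haug⟩
  obtain ⟨par, rk, y₀, hI, hD⟩ := CardMatching.exists_invariants hM hsearch
  exact CardMatching.augmentingPaths_graphH hM hI hD haug
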